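/- Let $d\ge 1$ be an integer and $\mathbb{R}_+=(0,\infty)$. Let $C_0[0,\infty)$ be the set of continuous functions $f_0:[0,\infty)\to\mathbb{C}$ with $\lim_{t\to\infty}f_0(t)=0$. For an integer $m\ge 1$, let $V_m(\mathbb{R}_+)$ be the set of functions $f:\mathbb{R}_+\to\mathbb{C}$ such that $f\in C^{m-1}(\mathbb{R}_+)$, the function $f^{(m-1)}$ is on $\mathbb{R}_+$ an indefinite integral of a function $f^{(m)}$ that has bounded variation on every interval $[a,b]\subset\mathbb{R}_+$ (normalized to be right-continuous, that is, $f^{(m)}$ is the right derivative of $f^{(m-1)}$), and $$\sup_{t\in\mathbb{R}_+}|f(t)|+\int_0^\infty t^m\,\bigl|df^{(m)}(t)\bigr|<\infty ,$$ where $|df^{(m)}|$ is the total variation measure of $f^{(m)}$. Let $A(\mathbb{R}^d)$ be the set of functions $f:\mathbb{R}^d\to\mathbb{C}$ for which there is $g\in L_1(\mathbb{R}^d)$ with $f(x)=\int_{\mathbb{R}^d}g(y)e^{-i(x,y)}\,dy$ for all $x\in\mathbb{R}^d$, where $(x,y)=\sum_{j=1}^d x_jy_j$. Put $|x|_{p,d}=\bigl(\sum_{j=1}^d|x_j|^p\bigr)^{1/p}$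 for $1\le p<\infty$ and $|x|_{\infty,d}=\max_{1\le j\le d}|x_j|$. If $f_0\in C_0[0,\infty)$ and $f_0\in V_d(\mathbb{R}_+)$, then $f_0(|x|_{p,d})\in A(\mathbb{R}^d)$ for every $p\in[1,\infty]$. -/

import Mathlib

open Set Filter Topology MeasureTheory
open scoped ENNReal

/-- Closed bounded order intervals of `(0, ∞)` are compact. -/
theorem compactIccSpace_Ioi_zero : CompactIccSpace (Ioi (0 : ℝ)) := by
  refine ⟨fun {a b} => ?_⟩
  rw [Topology.IsInducing.subtypeVal.isCompact_iff]
  have h : (Subtype.val '' Icc a b : Set ℝ) = Icc (a : ℝ) b := by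
    ext x
    constructor
    · rintro ⟨y, hy, rfl⟩
      exact hy
    · intro hx
      exact ⟨⟨x, lt_of_lt_of_le a.2 hx.1⟩, hx, rfl⟩
  rw [h]
  exact isCompact_Icc

attribute [local instance] compactIccSpace_Ioi_zero

/-- The variation function `t ↦ Var(g; [1, t])` (counted negatively for `t < 1`) of a function `g`
which has bounded variation on every `[a, b] ⊆ (0, ∞)` is monotone on `(0, ∞)`. -/
theorem monotone_variationFunction {g : ℝ → ℂ} (hg : LocallyBoundedVariationOn g (Ioi 0)) :
    Monotone (fun t : Ioi (0 : ℝ) => variationOnFromTo g (Ioi 0) 1 t) :=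
  fun s t hst => variationOnFromTo.monotoneOn hg (mem_Ioi.2 one_pos) s.2 t.2 hst

/-- The measure `|dg|` on `(0, ∞)`: the Lebesgue–Stieltjes measure of the variation function
of `g`. (For right-continuous `g`, the mass of `(a, b]` is the total variation of `g` on
`[a, b]`.) -/
noncomputable def variationMeasure {g : ℝ → ℂ} (hg : LocallyBoundedVariationOn g (Ioi 0)) :
    Measure (Ioi (0 : ℝ)) :=
  (monotone_variationFunction hg).stieltjesFunction.measure

/-- `g` represents the derivative `f^{(m)}`, `m ≥ 1`, on `(0, ∞)` as a function of locally bounded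
variation: `f` is `m - 1` times continuously differentiable on `(0, ∞)`, the function `g` has
bounded variation on every `[a, b] ⊆ (0, ∞)`, and `f^{(m-1)}` is an integral of `g`, so that
`f^{(m)} = g` off the countable set of jumps of `g`. At the jumps `g` is normalized by
right-continuity, so `g` is the right derivative of `f^{(m-1)}` at every point and
is uniquely determined on `(0, ∞)`. -/
structure IsBVDeriv (m : ℕ) (f g : ℝ → ℂ) : Prop where
  contDiffOn : ContDiffOn ℝ ((m - 1 : ℕ) : ℕ∞) f (Ioi 0)
  locallyBV : LocallyBoundedVariationOn g (Ioi 0)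
  rightCont : ∀ t, 0 < t → ContinuousWithinAt g (Ici t) t
  integral_eq : ∀ a b, 0 < a → a ≤ b →
    iteratedDeriv (m - 1) f b - iteratedDeriv (m - 1) f a = ∫ t in a..b, g t

/-- The class `V_m(ℝ₊)`, `ℝ₊ = (0, ∞)`, `m ≥ 1`: the functions `f` such that `f^{(m)}` has locally
bounded variation and `sup_{t > 0} |f(t)| + ∫₀^∞ t^m |df^{(m)}(t)| < ∞`. -/
def MemV (m : ℕ) (f : ℝ → ℂ) : Prop :=
  (∃ C : ℝ, ∀ t, 0 < t → ‖f t‖ ≤ C) ∧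
  ∃ (g : ℝ → ℂ) (hg : IsBVDeriv m f g),
    ∫⁻ t : Ioi (0 : ℝ), ENNReal.ofReal ((t : ℝ) ^ m) ∂(variationMeasure hg.locallyBV) < ∞

/-- The Wiener algebra `A(ℝ^d)` of Fourier transforms
`f(x) = ∫ g(y) e^{-i(x,y)} dy` of functions `g ∈ L₁(ℝ^d)`. -/
def MemWienerAlgebra (d : ℕ) (f : (Fin d → ℝ) → ℂ) : Prop :=
  ∃ g : (Fin d → ℝ) → ℂ, Integrable g ∧
    ∀ x, f x = ∫ y, g y * Complex.exp (-Complex.I * ((∑ j, x j * y j : ℝ) : ℂ))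

/-! Integrating back from infinity gives `f₀ t = (-1)^(d+1) ∫ (u - t)_+^d / d! df₀^{(d)}(u)` for `t
> 0`: the two sides differ by a polynomial, and both tend to zero (`eq_stieltjesPotential`,
`MemV.exists_eq_stieltjesPotential`). Put `t = |x|_p`. By homogeneity `f₀(|x|_p)` is a superposition
of the functions `u^d Φ(x/u)` with the single profile `Φ(x) = (1 - |x|_p)_+^d / d!`. Dilation does
not change the `L¹` norm of the representing density, so the moment condition `∫ u^d |df₀^{(d)}| <
∞` is what makes the superposition converge in the algebra (`MemWienerAlgebra.integral_dilation`).
It remains to show that `Φ` lies in the algebra.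

For `p < ∞`, consider first `(1 - ∑ |x_j|^p)_+^d`. Its mixed derivative `∂₁ ⋯ ∂_d` is bounded and
supported in the unit cube (`integral_simplexDensity`). Multiplication by `e^{-∑ x_j}` is reversible
on a compact support (`MemWienerAlgebra.of_mul_exp`) and turns the Fourier transform into `∏ (1 + i
y_j)⁻¹` times the transform of an `L²` function. By Plancherel both factors are in `L²`, so the
product is integrable and Fourier inversion applies. Taylor's formula at `s = 1` then writes `(1 -
s^{1/p})_+^d` as a superposition of functions `(v - s)_+^d`, which are dilations again once `s = ∑
|x_j|^p` (`exists_truncPow_one_sub_rpow_eq`).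

For `p = ∞` the profile is a superposition of cubes, and the weighted transform is `∏ (1 + i y_j)⁻¹`
times a signed sum of integrals `∫₀¹ a(u) e^{uw} du` with `Im w = ∑ ± y_j`. One integration by parts
yields the extra decay `(1 + (∑ ± y_j)²)^{-1/2}`. This makes the product integrable: the smallest of
the `d + 1` weights can be shared among the others, raising each exponent to `1 + 1/d`
(`integrable_prod_japaneseInv_mul`). -/

/-! ### Fourier inversion and Plancherel for the unnormalized transform -/

/-- The unnormalized Fourier transform `y ↦ ∫ f(x) e^{-i(x,y)} dx` on `ℝ^d`. -/
noncomputable def fourierPi {d : ℕ} (f : (Fin d → ℝ) → ℂ) (y : Fin d → ℝ) : ℂ :=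
  ∫ x, f x * Complex.exp (-Complex.I * ((∑ j, x j * y j : ℝ) : ℂ))

theorem norm_exp_neg_I_mul_ofReal (t : ℝ) : ‖Complex.exp (-Complex.I * (t : ℂ))‖ = 1 := by
  simpa [mul_comm] using Complex.norm_exp_ofReal_mul_I (-t)

open FourierTransform in
/-- The Fourier transform on `EuclideanSpace` is a rescaling of `fourierPi`. -/
theorem fourier_ofLp_eq {d : ℕ} (f : (Fin d → ℝ) → ℂ) (w : EuclideanSpace ℝ (Fin d)) :
    𝓕 (fun v : EuclideanSpace ℝ (Fin d) => f (WithLp.ofLp v)) w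
      = fourierPi f ((2 * Real.pi) • WithLp.ofLp w) := by
  rw [Real.fourier_eq', fourierPi]
  rw [← (EuclideanSpace.volume_preserving_symm_measurableEquiv_toLp (Fin d)).symm.integral_comp
    (MeasurableEquiv.measurableEmbedding _)]
  refine integral_congr_ae (Eventually.of_forall fun v => ?_)
  simp only [MeasurableEquiv.symm_symm]
  rw [smul_eq_mul, mul_comm]
  congr 1
  simp [PiLp.inner_apply, Finset.mul_sum, mul_comm, mul_left_comm, mul_assoc]

open FourierTransform in
/-- A continuous integrable function with integrable Fourier transform is in the Wiener algebra. -/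
theorem memWienerAlgebra_of_integrable_fourierPi {d : ℕ} {f : (Fin d → ℝ) → ℂ} (hc : Continuous f)
    (hf : Integrable f) (hF : Integrable (fourierPi f)) : MemWienerAlgebra d f := by
  have h2 : (2 * Real.pi) ≠ 0 := by positivity
  set fE : EuclideanSpace ℝ (Fin d) → ℂ := fun v => f (WithLp.ofLp v) with hfE
  have hmp := PiLp.volume_preserving_ofLp (Fin d)
  have hme : MeasurableEmbedding (@WithLp.ofLp 2 (Fin d → ℝ)) :=
    (MeasurableEquiv.toLp 2 (Fin d → ℝ)).symm.measurableEmbedding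
  have hfEi : Integrable fE := (hmp.integrable_comp_emb hme).2 hf
  have hFE : 𝓕 fE = (fun y => fourierPi f ((2 * Real.pi) • y)) ∘ WithLp.ofLp := by
    ext w
    exact fourier_ofLp_eq f w
  have hFEi : Integrable (𝓕 fE) := by
    rw [hFE]
    exact (hmp.integrable_comp_emb hme).2 (hF.comp_smul h2)
  have hcE : Continuous fE := hc.comp (PiLp.continuous_ofLp 2 _)
  have hinv := hcE.fourier_fourierInv_eq hfEi hFEi
  set G : (Fin d → ℝ) → ℂ := fun y => fourierPi f ((2 * Real.pi) • (-y)) with hG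
  have hG' : 𝓕⁻ fE = fun v : EuclideanSpace ℝ (Fin d) => G (WithLp.ofLp v) := by
    ext w
    rw [Real.fourierInv_eq_fourier_neg, hFE]
    rfl
  have hGi : Integrable G := (hF.comp_smul h2).comp_neg
  rw [hG'] at hinv
  -- After unfolding `G` the density is `(2π)^{-d} fourierPi f (-y)`; the inner scaling undoes the
  -- `2π` in the exponent of `𝓕`.
  refine ⟨fun y => (((2 * Real.pi)⁻¹ ^ d : ℝ) : ℂ) * G ((2 * Real.pi)⁻¹ • y),
    (hGi.comp_smul (inv_ne_zero h2)).const_mul _, fun x => ?_⟩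
  have h3 : f x = 𝓕 (fun v : EuclideanSpace ℝ (Fin d) => G (WithLp.ofLp v)) (WithLp.toLp 2 x) := by
    rw [hinv]
  rw [h3, fourier_ofLp_eq, fourierPi]
  have h4 := Measure.integral_comp_smul (volume : Measure (Fin d → ℝ))
    (fun y : Fin d → ℝ => G y * Complex.exp (-Complex.I *
      ((∑ j, y j * ((2 * Real.pi) • x) j : ℝ) : ℂ))) ((2 * Real.pi)⁻¹)
  simp only [mul_assoc]
  rw [integral_const_mul]
  have h5 : ∀ y : Fin d → ℝ, (∑ j, ((2 * Real.pi)⁻¹ • y) j * ((2 * Real.pi) • x) j) =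
      ∑ j, x j * y j := by
    intro y
    refine Finset.sum_congr rfl fun j _ => ?_
    simp only [Pi.smul_apply, smul_eq_mul]
    field_simp
  simp only [h5] at h4
  rw [h4]
  simp only [Module.finrank_fin_fun, inv_pow, inv_inv]
  rw [abs_of_pos (by positivity), Complex.real_smul, ← mul_assoc, ← Complex.ofReal_mul,
    inv_mul_cancel₀ (by positivity), Complex.ofReal_one, one_mul]

open FourierTransform SchwartzMap in
/-- Plancherel: the Fourier transform of a function in `L¹ ∩ L²` is in `L²`. -/
theorem memLp_two_fourier {d : ℕ} {f : EuclideanSpace ℝ (Fin d) → ℂ} (hf : Integrable f)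
    (hf2 : MemLp f 2) : MemLp (𝓕 f) 2 := by
  have hc : Continuous (𝓕 f) := by
    exact VectorFourier.fourierIntegral_continuous Real.continuous_fourierChar
      (by exact continuous_inner) hf
  -- The Fourier integral and the `L²` extension are compared by testing against smooth compactly
  -- supported functions: on either side the transform can be moved onto the test function.
  have key : 𝓕 f =ᵐ[volume] (𝓕 (hf2.toLp f) : Lp ℂ 2 (volume : Measure (EuclideanSpace ℝ (Fin d)))) := by
    refine ae_eq_of_integral_contDiff_smul_eq hc.locallyIntegrable
      ((Lp.memLp _).locallyIntegrable (by norm_num)) fun g hg hgs => ?_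
    set φ : 𝓢(EuclideanSpace ℝ (Fin d), ℂ) :=
      (hgs.comp_left (g := fun x : ℝ => (x : ℂ)) Complex.ofReal_zero).toSchwartzMap
        (Complex.ofRealCLM.contDiff.comp hg) with hφ
    have hφv : ∀ x, φ x = (g x : ℂ) := fun x => rfl
    have h1 := congrArg (fun T => T φ) (Lp.fourier_toTemperedDistribution_eq (hf2.toLp f))
    simp only [TemperedDistribution.fourier_apply, Lp.toTemperedDistribution_apply] at h1
    have h2 := VectorFourier.integral_fourierIntegral_smul_eq_flip (L := innerₗ _)
      (μ := (volume : Measure (EuclideanSpace ℝ (Fin d)))) (ν := volume) Real.continuous_fourierChar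
      (by exact continuous_inner) hf φ.integrable
    have h3 : ∀ x, g x • (𝓕 (hf2.toLp f) : Lp ℂ 2 (volume : Measure (EuclideanSpace ℝ (Fin d)))) x = φ x • (𝓕 (hf2.toLp f) : Lp ℂ 2 (volume : Measure (EuclideanSpace ℝ (Fin d)))) x := by
      intro x; simp [hφv]
    simp_rw [h3]
    rw [← h1]
    have h4 : ∫ x, (𝓕 φ) x • (hf2.toLp f) x = ∫ x, (𝓕 φ) x • f x := by
      refine integral_congr_ae ?_
      filter_upwards [hf2.coeFn_toLp] with x hx
      rw [hx]
    rw [h4]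
    have h5 : ∫ x, (𝓕 φ) x • f x = ∫ x, f x • 𝓕 (⇑φ) x := by
      simp only [smul_eq_mul, SchwartzMap.fourier_coe]
      simp_rw [mul_comm]
    rw [h5]
    have h6 : ∫ x, g x • 𝓕 f x = ∫ x, 𝓕 f x • φ x := by
      refine integral_congr_ae (Eventually.of_forall fun x => ?_)
      simp [hφv, mul_comm]
    rw [h6]
    have hfl : (innerₗ (EuclideanSpace ℝ (Fin d))).flip = innerₗ _ := by
      ext x y; simp
    rw [hfl] at h2
    exact h2
  exact (memLp_congr_ae key).2 (Lp.memLp _)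

/-- Plancherel: the Fourier transform of a function in `L¹ ∩ L²` is in `L²`. -/
theorem memLp_two_fourierPi {d : ℕ} {f : (Fin d → ℝ) → ℂ} (hf : Integrable f)
    (hf2 : MemLp f 2) : MemLp (fourierPi f) 2 := by
  have h2 : (2 * Real.pi)⁻¹ ≠ 0 := by positivity
  have hmp := PiLp.volume_preserving_ofLp (Fin d)
  have hme : MeasurableEmbedding (@WithLp.ofLp 2 (Fin d → ℝ)) :=
    (MeasurableEquiv.toLp 2 (Fin d → ℝ)).symm.measurableEmbedding
  have h := memLp_two_fourier (f := fun v : EuclideanSpace ℝ (Fin d) => f (WithLp.ofLp v))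
    ((hmp.integrable_comp_emb hme).2 hf) (hf2.comp_measurePreserving hmp)
  have h' := h.comp_measurePreserving (PiLp.volume_preserving_toLp (Fin d))
  have h3 : fourierPi f = fun y => (fun w => fourierPi f ((2 * Real.pi) • w)) ((2 * Real.pi)⁻¹ • y) := by
    ext y
    simp only
    rw [smul_inv_smul₀ (by positivity)]
  have h4 : MemLp (fun w => fourierPi f ((2 * Real.pi) • w)) 2 := by
    refine h'.congr_norm ?_ (Eventually.of_forall fun y => ?_)
    · refine h'.aestronglyMeasurable.congr (Eventually.of_forall fun y => ?_)
      exact fourier_ofLp_eq f _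
    · simp only [Function.comp]
      rw [fourier_ofLp_eq]
  rw [h3]
  have hsq := (memLp_two_iff_integrable_sq_norm h4.aestronglyMeasurable).1 h4
  have hq : AEStronglyMeasurable (fun y => (fun w => fourierPi f ((2 * Real.pi) • w)) ((2 * Real.pi)⁻¹ • y)) := by
    refine h4.aestronglyMeasurable.comp_quasiMeasurePreserving
      (f := fun y : Fin d → ℝ => (2 * Real.pi)⁻¹ • y) ⟨measurable_const_smul _, ?_⟩
    rw [Measure.map_addHaar_smul _ h2]
    exact Measure.smul_absolutelyContinuous
  exact (memLp_two_iff_integrable_sq_norm hq).2 (hsq.comp_smul h2)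

/-! ### Algebraic operations and dilation averages in the Wiener algebra -/

section WienerAlgebra

variable {d : ℕ}

theorem continuous_exp_neg_I_mul_sum (x : Fin d → ℝ) :
    Continuous fun y : Fin d → ℝ => Complex.exp (-Complex.I * ((∑ j, x j * y j : ℝ) : ℂ)) := by
  fun_prop

theorem MeasureTheory.Integrable.mul_exp_neg_I {g : (Fin d → ℝ) → ℂ} (hg : Integrable g)
    (x : Fin d → ℝ) :
    Integrable fun y => g y * Complex.exp (-Complex.I * ((∑ j, x j * y j : ℝ) : ℂ)) := by
  refine hg.mul_bdd (c := 1) (continuous_exp_neg_I_mul_sum x).aestronglyMeasurable ?_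
  exact Eventually.of_forall fun y => (norm_exp_neg_I_mul_ofReal _).le

theorem MemWienerAlgebra.add {f₁ f₂ : (Fin d → ℝ) → ℂ} (h₁ : MemWienerAlgebra d f₁)
    (h₂ : MemWienerAlgebra d f₂) : MemWienerAlgebra d (fun x => f₁ x + f₂ x) := by
  obtain ⟨g₁, hg₁, e₁⟩ := h₁
  obtain ⟨g₂, hg₂, e₂⟩ := h₂
  refine ⟨fun y => g₁ y + g₂ y, hg₁.add hg₂, fun x => ?_⟩
  simp only [add_mul]
  rw [integral_add (hg₁.mul_exp_neg_I x) (hg₂.mul_exp_neg_I x), e₁, e₂]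

theorem MemWienerAlgebra.const_mul {f : (Fin d → ℝ) → ℂ} (h : MemWienerAlgebra d f) (c : ℂ) :
    MemWienerAlgebra d (fun x => c * f x) := by
  obtain ⟨g, hg, e⟩ := h
  refine ⟨fun y => c * g y, hg.const_mul c, fun x => ?_⟩
  simp only [mul_assoc]
  rw [integral_const_mul, e]

-- The convolution of the two densities represents the product, because the character at `y` factors
-- into its values at `t` and `y - t`.
open scoped Convolution in
theorem MemWienerAlgebra.mul {f₁ f₂ : (Fin d → ℝ) → ℂ} (h₁ : MemWienerAlgebra d f₁)
    (h₂ : MemWienerAlgebra d f₂) : MemWienerAlgebra d (fun x => f₁ x * f₂ x) := by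
  obtain ⟨g₁, hg₁, e₁⟩ := h₁
  obtain ⟨g₂, hg₂, e₂⟩ := h₂
  refine ⟨g₁ ⋆[ContinuousLinearMap.mul ℝ ℂ, volume] g₂, hg₁.integrable_convolution _ hg₂,
    fun x => ?_⟩
  have h := integral_convolution (ContinuousLinearMap.mul ℝ ℂ) (hg₁.mul_exp_neg_I x)
    (hg₂.mul_exp_neg_I x)
  rw [ContinuousLinearMap.mul_apply', ← e₁, ← e₂] at h
  change f₁ x * f₂ x = _
  rw [← h]
  refine integral_congr_ae (Eventually.of_forall fun y => ?_)
  simp only [convolution_def, ContinuousLinearMap.mul_apply']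
  rw [← integral_mul_const]
  refine integral_congr_ae (Eventually.of_forall fun t => ?_)
  have : Complex.exp (-Complex.I * ((∑ j, x j * y j : ℝ) : ℂ)) =
      Complex.exp (-Complex.I * ((∑ j, x j * t j : ℝ) : ℂ)) *
        Complex.exp (-Complex.I * ((∑ j, x j * (y - t) j : ℝ) : ℂ)) := by
    rw [← Complex.exp_add, ← mul_add, ← Complex.ofReal_add, ← Finset.sum_add_distrib]
    simp [mul_sub]
  simp only [this]
  ring

open FourierTransform SchwartzMap ContDiff in
/-- Smooth functions with compact support are in the Wiener algebra. -/
theorem memWienerAlgebra_of_contDiff {f : (Fin d → ℝ) → ℂ} (hf : ContDiff ℝ ∞ f)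
    (hs : HasCompactSupport f) : MemWienerAlgebra d f := by
  refine memWienerAlgebra_of_integrable_fourierPi hf.continuous
    (hf.continuous.integrable_of_hasCompactSupport hs) ?_
  set φ : 𝓢(EuclideanSpace ℝ (Fin d), ℂ) :=
    (hs.comp_homeomorph (PiLp.homeomorph 2 fun _ : Fin d => ℝ)).toSchwartzMap
      (hf.comp (PiLp.continuousLinearEquiv 2 ℝ fun _ : Fin d => ℝ).contDiff) with hφ
  have hφv : (φ : EuclideanSpace ℝ (Fin d) → ℂ) = fun v => f (WithLp.ofLp v) := rfl
  have h1 : Integrable (𝓕 (φ : EuclideanSpace ℝ (Fin d) → ℂ)) := by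
    rw [← SchwartzMap.fourier_coe]
    exact (𝓕 φ).integrable
  have h2 : 𝓕 (φ : EuclideanSpace ℝ (Fin d) → ℂ) =
      (fun y => fourierPi f ((2 * Real.pi) • y)) ∘ WithLp.ofLp := by
    ext w
    rw [hφv]
    exact fourier_ofLp_eq f w
  have hmp := PiLp.volume_preserving_ofLp (Fin d)
  have hme : MeasurableEmbedding (@WithLp.ofLp 2 (Fin d → ℝ)) :=
    (MeasurableEquiv.toLp 2 (Fin d → ℝ)).symm.measurableEmbedding
  rw [h2, hmp.integrable_comp_emb hme] at h1
  exact (integrable_comp_smul_iff volume _ (by positivity)).1 h1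

open ContDiff in
/-- An exponential weight does not affect membership in the Wiener algebra for functions supported
in the unit cube. -/
theorem MemWienerAlgebra.of_mul_exp {F : (Fin d → ℝ) → ℂ}
    (h : MemWienerAlgebra d fun x => F x * Complex.exp (-((∑ j, x j : ℝ) : ℂ)))
    (hF : ∀ x, 1 < ‖x‖ → F x = 0) : MemWienerAlgebra d F := by
  set χ : ContDiffBump (0 : Fin d → ℝ) := ⟨1, 2, one_pos, one_lt_two⟩
  -- The bump equals `1` on the unit cube, so this smooth compactly supported factor cancels the
  -- weight wherever `F` can be nonzero.
  have hw : MemWienerAlgebra d fun x => (χ x : ℂ) * Complex.exp ((∑ j, x j : ℝ) : ℂ) := by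
    refine memWienerAlgebra_of_contDiff ?_ ?_
    · refine (Complex.ofRealCLM.contDiff.comp χ.contDiff).mul ?_
      have hsum : ContDiff ℝ ∞ fun x : Fin d → ℝ => ∑ j, x j :=
        ContDiff.sum fun j _ => contDiff_apply ℝ ℝ j
      exact (Complex.ofRealCLM.contDiff.comp hsum).cexp
    · exact (χ.hasCompactSupport.comp_left Complex.ofReal_zero).mul_right
  convert h.mul hw using 2 with x
  by_cases hx : 1 < ‖x‖
  · simp [hF x hx]
  · rw [χ.one_of_mem_closedBall (by simpa using not_lt.1 hx), mul_assoc, Complex.ofReal_one,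
      one_mul, ← Complex.exp_add]
    simp

/-- Integrals of dilations of a function of the Wiener algebra are in the Wiener algebra. -/
theorem MemWienerAlgebra.integral_dilation {Ω : Type*} [MeasurableSpace Ω] {ρ : Measure Ω}
    [SFinite ρ] {Φ : (Fin d → ℝ) → ℂ} (hΦ : MemWienerAlgebra d Φ) {u : Ω → ℝ} (hu : Measurable u)
    (hpos : ∀ ω, 0 < u ω) {h : Ω → ℂ} (hh : Integrable h ρ) :
    MemWienerAlgebra d (fun x => ∫ ω, h ω * Φ ((u ω)⁻¹ • x) ∂ρ) := by
  obtain ⟨g₀, hg₀, e₀⟩ := hΦ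
  -- A strongly measurable representative is needed for joint measurability of `(ω, y) ↦ g (u ω •
  -- y)`.
  obtain ⟨g, hgm, hgg⟩ := hg₀.aestronglyMeasurable
  have hg : Integrable g := hg₀.congr hgg
  have e : ∀ x, Φ x = ∫ y, g y * Complex.exp (-Complex.I * ((∑ j, x j * y j : ℝ) : ℂ)) := by
    intro x
    rw [e₀]
    refine integral_congr_ae ?_
    filter_upwards [hgg] with y hy
    rw [hy]
  -- For fixed `ω`, `u^d g(u y)` is the density of `Φ(x/u)`, with `L¹` norm independent of `u`;
  -- hence integrability of `h` alone gives integrability of `k`.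
  set k : Ω × (Fin d → ℝ) → ℂ := fun q => h q.1 * (((u q.1) ^ d : ℝ) * g (u q.1 • q.2)) with hk
  have hscale : ∀ ω, ∀ F : (Fin d → ℝ) → ℂ,
      ∫ y, (((u ω) ^ d : ℝ) : ℂ) * F (u ω • y) = ∫ y, F y := by
    intro ω F
    rw [integral_const_mul, Measure.integral_comp_smul, Module.finrank_fin_fun,
      abs_of_pos (by have := hpos ω; positivity), Complex.real_smul, ← mul_assoc,
      ← Complex.ofReal_mul, mul_inv_cancel₀ (by have := hpos ω; positivity)]
    simp
  have hscale' : ∀ ω, ∫ y, ‖(((u ω) ^ d : ℝ) : ℂ) * g (u ω • y)‖ = ∫ y, ‖g y‖ := by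
    intro ω
    have h1 : ∀ y, ‖(((u ω) ^ d : ℝ) : ℂ) * g (u ω • y)‖ = (u ω) ^ d * ‖g (u ω • y)‖ := by
      intro y
      rw [norm_mul, Complex.norm_real, Real.norm_of_nonneg (by have := hpos ω; positivity)]
    simp_rw [h1]
    rw [integral_const_mul, Measure.integral_comp_smul volume (fun y => ‖g y‖),
      Module.finrank_fin_fun,
      abs_of_pos (by have := hpos ω; positivity), smul_eq_mul, ← mul_assoc,
      mul_inv_cancel₀ (by have := hpos ω; positivity), one_mul]
  have hkm : AEStronglyMeasurable k (ρ.prod volume) := by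
    refine hh.aestronglyMeasurable.comp_fst.mul ?_
    refine AEStronglyMeasurable.mul ?_ ?_
    · exact (by fun_prop : Measurable fun q : Ω × (Fin d → ℝ) =>
        (((u q.1) ^ d : ℝ) : ℂ)).aestronglyMeasurable
    · refine (hgm.comp_measurable ?_).aestronglyMeasurable
      fun_prop
  have hki : Integrable k (ρ.prod volume) := by
    rw [integrable_prod_iff hkm]
    constructor
    · refine Eventually.of_forall fun ω => ?_
      exact ((hg.comp_smul (hpos ω).ne').const_mul (((u ω) ^ d : ℝ) : ℂ)).const_mul (h ω)
    · simp only [hk, norm_mul (h _)]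
      simp_rw [integral_const_mul, hscale']
      exact hh.norm.mul_const _
  refine ⟨fun y => ∫ ω, k (ω, y) ∂ρ, hki.integral_prod_right, fun x => ?_⟩
  have hke : Integrable (fun q : Ω × (Fin d → ℝ) =>
      k q * Complex.exp (-Complex.I * ((∑ j, x j * q.2 j : ℝ) : ℂ))) (ρ.prod volume) := by
    refine hki.mul_bdd (c := 1) ?_ (Eventually.of_forall fun q => (norm_exp_neg_I_mul_ofReal _).le)
    exact ((continuous_exp_neg_I_mul_sum x).measurable.comp measurable_snd).aestronglyMeasurable
  simp_rw [← integral_mul_const]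
  rw [← integral_integral_swap (f := fun ω y =>
    k (ω, y) * Complex.exp (-Complex.I * ((∑ j, x j * y j : ℝ) : ℂ))) hke]
  refine integral_congr_ae (Eventually.of_forall fun ω => ?_)
  simp only [hk, mul_assoc]
  rw [integral_const_mul, e, ← hscale ω]
  congr 2
  ext y
  congr 4
  refine congrArg _ (Finset.sum_congr rfl fun j _ => ?_)
  have := (hpos ω).ne'
  simp only [Pi.smul_apply, smul_eq_mul]
  field_simp

end WienerAlgebra

/-! ### The functions `(1 - ∑ |x_j|^p)_+^d` -/

/-- The truncated power `s_+^n / n!`, with `s_+^0` the indicator function of `(0, ∞)`. -/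
noncomputable def truncPow (n : ℕ) (s : ℝ) : ℝ := if 0 < s then s ^ n / n.factorial else 0

theorem truncPow_of_pos {n : ℕ} {s : ℝ} (hs : 0 < s) : truncPow n s = s ^ n / n.factorial :=
  if_pos hs

theorem truncPow_of_nonpos {n : ℕ} {s : ℝ} (hs : s ≤ 0) : truncPow n s = 0 :=
  if_neg (not_lt.2 hs)

theorem truncPow_nonneg (n : ℕ) (s : ℝ) : 0 ≤ truncPow n s := by
  unfold truncPow
  split_ifs <;> positivity

theorem truncPow_le_one (n : ℕ) {s : ℝ} (hs : s ≤ 1) : truncPow n s ≤ 1 := by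
  unfold truncPow
  split_ifs with h
  · exact div_le_one_of_le₀ ((pow_le_one₀ h.le hs).trans (by exact_mod_cast n.factorial_pos))
      (by positivity)
  · exact zero_le_one

theorem truncPow_eq_max {n : ℕ} (hn : n ≠ 0) (s : ℝ) :
    truncPow n s = (max s 0) ^ n / n.factorial := by
  unfold truncPow
  split_ifs with h
  · rw [max_eq_left h.le]
  · rw [max_eq_right (not_lt.1 h), zero_pow hn, zero_div]

theorem continuous_truncPow {n : ℕ} (hn : n ≠ 0) : Continuous (truncPow n) := by
  rw [funext (truncPow_eq_max hn)]
  fun_prop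

theorem measurable_truncPow (n : ℕ) : Measurable (truncPow n) :=
  Measurable.ite measurableSet_Ioi (by fun_prop) measurable_const

theorem hasDerivAt_truncPow (n : ℕ) {s : ℝ} (hs : s ≠ 0) :
    HasDerivAt (truncPow (n + 1)) (truncPow n s) s := by
  rcases hs.lt_or_gt with h | h
  · rw [truncPow_of_nonpos h.le]
    refine (hasDerivAt_const s (0 : ℝ)).congr_of_eventuallyEq ?_
    filter_upwards [Iio_mem_nhds h] with x hx
    exact truncPow_of_nonpos (le_of_lt hx)
  · rw [truncPow_of_pos h]
    have h1 : HasDerivAt (fun x : ℝ => x ^ (n + 1) / (n + 1).factorial) (s ^ n / n.factorial) s := by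
      refine ((hasDerivAt_pow (n + 1) s).div_const _).congr_deriv ?_
      rw [Nat.factorial_succ]
      push_cast
      field_simp
    refine h1.congr_of_eventuallyEq ?_
    filter_upwards [Ioi_mem_nhds h] with x hx
    exact truncPow_of_pos hx

/-- The derivative of `|t|^p`. -/
noncomputable def absRpowDeriv (p t : ℝ) : ℝ := p * |t| ^ (p - 2) * t

theorem measurable_absRpowDeriv (p : ℝ) : Measurable (absRpowDeriv p) := by
  unfold absRpowDeriv
  fun_prop

theorem hasDerivAt_abs_rpow_of_ne {p t : ℝ} (ht : t ≠ 0) :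
    HasDerivAt (fun x => |x| ^ p) (absRpowDeriv p t) t := by
  have h := (hasDerivAt_abs ht).rpow_const (p := p) (Or.inl (abs_ne_zero.2 ht))
  refine h.congr_deriv ?_
  unfold absRpowDeriv
  have h0 : 0 < |t| := abs_pos.2 ht
  have h1 : |t| ^ (p - 1) = |t| ^ (p - 2) * |t| := by
    rw [← Real.rpow_add_one h0.ne']; congr 1; ring
  have h2 : |t| * (SignType.sign t : ℝ) = t := abs_mul_sign t
  rw [h1]
  linear_combination (p * |t| ^ (p - 2)) * h2

/-- The size is `p |t|^{p-1}`, and `1 ≤ p` makes the exponent nonnegative. The extra factor `t` in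
the definition gives the value `0` at the origin, even where `|t|^{p-2}` is singular. -/
theorem abs_absRpowDeriv_le {p t : ℝ} (hp : 1 ≤ p) (ht : |t| ≤ 1) : |absRpowDeriv p t| ≤ p := by
  unfold absRpowDeriv
  rcases eq_or_ne t 0 with rfl | h
  · simp; linarith
  have h0 : 0 < |t| := abs_pos.2 h
  rw [abs_mul, abs_mul, abs_of_pos (by linarith : 0 < p), abs_of_nonneg (by positivity), mul_assoc,
    ← Real.rpow_add_one h0.ne']
  have : |t| ^ (p - 2 + 1) ≤ 1 := Real.rpow_le_one h0.le ht (by linarith)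
  nlinarith

/-- The mixed derivative `∂₁ ⋯ ∂_n` of `(c - ∑ |t_j|^p)_+^n / n!`. -/
noncomputable def simplexDensity (p : ℝ) (n : ℕ) (c : ℝ) (t : Fin n → ℝ) : ℝ :=
  truncPow 0 (c - ∑ j, |t j| ^ p) * ∏ j, -absRpowDeriv p (t j)

theorem measurable_simplexDensity (p : ℝ) (n : ℕ) :
    Measurable fun q : ℝ × (Fin n → ℝ) => simplexDensity p n q.1 q.2 := by
  unfold simplexDensity
  refine ((measurable_truncPow 0).comp (by fun_prop)).mul ?_
  exact Finset.measurable_prod _ fun j _ => ((measurable_absRpowDeriv p).comp (by fun_prop)).neg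

theorem simplexDensity_eq_zero {p : ℝ} (hp : 1 ≤ p) {n : ℕ} {c : ℝ} (hc : c ≤ 1) {t : Fin n → ℝ}
    {j : Fin n} (hj : 1 < |t j|) : simplexDensity p n c t = 0 := by
  unfold simplexDensity
  rw [truncPow_of_nonpos, zero_mul]
  have h1 := Real.one_le_rpow hj.le (by linarith : 0 ≤ p)
  have h2 := Finset.single_le_sum (f := fun j => |t j| ^ p) (fun i _ => by positivity)
    (Finset.mem_univ j)
  linarith

theorem abs_simplexDensity_le {p : ℝ} (hp : 1 ≤ p) (n : ℕ) {c : ℝ} (hc : c ≤ 1) (t : Fin n → ℝ) :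
    |simplexDensity p n c t| ≤ p ^ n := by
  by_cases h : ∃ j, 1 < |t j|
  · obtain ⟨j, hj⟩ := h
    rw [simplexDensity_eq_zero hp hc hj, abs_zero]
    positivity
  push Not at h
  unfold simplexDensity
  rw [abs_mul, Finset.abs_prod]
  have h1 : |truncPow 0 (c - ∑ j, |t j| ^ p)| ≤ 1 := by
    rw [abs_of_nonneg (truncPow_nonneg _ _)]
    refine truncPow_le_one _ ?_
    have : 0 ≤ ∑ j, |t j| ^ p := Finset.sum_nonneg fun i _ => by positivity
    linarith
  have h2 : ∏ j, |-absRpowDeriv p (t j)| ≤ p ^ n := by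
    refine (Finset.prod_le_prod (g := fun _ => p) (fun j _ => abs_nonneg _)
      fun j _ => (abs_neg _).trans_le (abs_absRpowDeriv_le hp (h j))).trans_eq ?_
    rw [Finset.prod_const, Finset.card_univ, Fintype.card_fin]
  calc _ ≤ 1 * p ^ n := mul_le_mul h1 h2 (Finset.prod_nonneg fun j _ => abs_nonneg _) zero_le_one
    _ = _ := one_mul _

theorem simplexDensity_eq_indicator {p : ℝ} (hp : 1 ≤ p) (n : ℕ) {c : ℝ} (hc : c ≤ 1) :
    (Metric.closedBall (0 : Fin n → ℝ) 1).indicator (simplexDensity p n c) =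
      simplexDensity p n c := by
  refine indicator_eq_self.2 fun t ht => ?_
  rw [mem_closedBall_zero_iff, pi_norm_le_iff_of_nonneg zero_le_one]
  intro j
  by_contra! h
  exact ht (simplexDensity_eq_zero hp hc h)

/-- Bounded continuous multiples of `simplexDensity` are in all `L^q`. -/
theorem memLp_simplexDensity_mul {p : ℝ} (hp : 1 ≤ p) (n : ℕ) {c : ℝ} (hc : c ≤ 1)
    {w : (Fin n → ℝ) → ℝ} (hw : Continuous w) (q : ℝ≥0∞) :
    MemLp (fun t => simplexDensity p n c t * w t) q := by
  have hcomp : IsCompact (Metric.closedBall (0 : Fin n → ℝ) 1) := isCompact_closedBall _ _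
  obtain ⟨C, hC⟩ := hcomp.exists_bound_of_continuousOn hw.continuousOn
  have h1 : (Metric.closedBall (0 : Fin n → ℝ) 1).indicator
      (fun t => simplexDensity p n c t * w t) = fun t => simplexDensity p n c t * w t := by
    conv_rhs => rw [← simplexDensity_eq_indicator hp n hc]
    ext t
    exact indicator_mul_left _ _ _
  rw [← h1, memLp_indicator_iff_restrict Metric.isClosed_closedBall.measurableSet]
  have : IsFiniteMeasure (volume.restrict (Metric.closedBall (0 : Fin n → ℝ) 1)) :=
    ⟨by rw [Measure.restrict_apply_univ]; exact hcomp.measure_lt_top⟩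
  refine MemLp.of_bound (C := p ^ n * C) ?_ ?_
  · exact (((measurable_simplexDensity p n).comp measurable_prodMk_left).mul
      hw.measurable).aestronglyMeasurable
  · refine (ae_restrict_mem Metric.isClosed_closedBall.measurableSet).mono fun t ht => ?_
    rw [norm_mul]
    exact mul_le_mul (abs_simplexDensity_le hp n hc t) (hC t ht) (norm_nonneg _) (by positivity)

theorem integrable_simplexDensity {p : ℝ} (hp : 1 ≤ p) (n : ℕ) {c : ℝ} (hc : c ≤ 1) :
    Integrable (simplexDensity p n c) := by
  have := memLp_simplexDensity_mul hp n hc (w := fun _ => 1) continuous_const 1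
  simpa [memLp_one_iff_integrable] using this

/-- Freezing one coordinate gives a density of the same kind with a smaller level `c`. This is why
`c` is kept as a parameter in the induction on dimension. -/
theorem simplexDensity_cons (p : ℝ) (n : ℕ) (c s : ℝ) (t : Fin n → ℝ) :
    simplexDensity p (n + 1) c (Fin.cons s t) =
      -absRpowDeriv p s * simplexDensity p n (c - |s| ^ p) t := by
  unfold simplexDensity
  rw [Fin.sum_univ_succ, Fin.prod_univ_succ]
  simp only [Fin.cons_zero, Fin.cons_succ, sub_sub]
  ring

/-- The fundamental theorem of calculus applied to `truncPow (n + 1) (c - |t|^p)`, which is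
continuous, vanishes for `t ≤ -1`, and is differentiable except at `0` and where `|t|^p = c`. -/
theorem integral_absRpowDeriv_mul_truncPow {p : ℝ} (hp : 1 ≤ p) (n : ℕ) {c : ℝ} (hc : c ≤ 1)
    (x : ℝ) :
    ∫ t, (if t < x then -absRpowDeriv p t * truncPow n (c - |t| ^ p) else 0) =
      truncPow (n + 1) (c - |x| ^ p) := by
  -- Below `-1` the integrand vanishes since `c ≤ 1`; the minimum keeps `a ≤ x`.
  set a := min (-1) x with ha
  have hax : a ≤ x := min_le_right _ _
  have hg0 : ∀ t, t ≤ a → ∀ m, truncPow m (c - |t| ^ p) = 0 := by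
    intro t ht m
    refine truncPow_of_nonpos ?_
    have h1 : 1 ≤ |t| := by
      have : t ≤ -1 := ht.trans (min_le_left _ _)
      rw [abs_of_neg (by linarith)]; linarith
    have := Real.one_le_rpow h1 (by linarith : 0 ≤ p)
    linarith
  have h1 : ∫ t, (if t < x then -absRpowDeriv p t * truncPow n (c - |t| ^ p) else 0) =
      ∫ t in a..x, -absRpowDeriv p t * truncPow n (c - |t| ^ p) := by
    rw [intervalIntegral.integral_of_le hax, ← integral_indicator measurableSet_Ioc]
    refine integral_congr_ae ?_
    have hx : ∀ᵐ t : ℝ, t ≠ x := Measure.ae_ne volume x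
    filter_upwards [hx] with t ht
    rcases ht.lt_or_gt with h | h
    · rw [if_pos h]
      by_cases hat : a < t
      · rw [indicator_of_mem (show t ∈ Ioc a x from ⟨hat, h.le⟩)]
      · rw [indicator_of_notMem (fun h' => hat h'.1), hg0 t (not_lt.1 hat), mul_zero]
    · rw [if_neg h.le.not_gt, indicator_of_notMem (fun h' => h.not_ge h'.2)]
  have hcnt : ({0} ∪ {c ^ p⁻¹, -(c ^ p⁻¹)} : Set ℝ).Countable :=
    (((finite_singleton _).insert _).countable).union (countable_singleton _) |>.mono (by
      intro y hy; simp only [mem_union, mem_insert_iff, mem_singleton_iff] at hy ⊢; tauto)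
  have hcont : Continuous fun t : ℝ => truncPow (n + 1) (c - |t| ^ p) :=
    (continuous_truncPow n.succ_ne_zero).comp
      (continuous_const.sub (continuous_abs.rpow_const fun t => Or.inr (by linarith)))
  rw [h1, integral_eq_of_hasDerivAt_off_countable (fun t => truncPow (n + 1) (c - |t| ^ p)) _ hcnt
    hcont.continuousOn, hg0 a le_rfl, sub_zero]
  · rintro t ⟨-, ht⟩
    simp only [mem_union, mem_insert_iff, mem_singleton_iff, not_or] at ht
    obtain ⟨ht0, ht1, ht2⟩ := ht
    have hne : c - |t| ^ p ≠ 0 := by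
      intro h
      have h3 : |t| = c ^ p⁻¹ := by
        rw [show c = |t| ^ p by linarith, Real.rpow_rpow_inv (abs_nonneg _) (by linarith)]
      rcases abs_choice t with h4 | h4
      · exact ht1 (h4 ▸ h3)
      · exact ht2 (by linarith)
    have := (hasDerivAt_truncPow n hne).comp t ((hasDerivAt_abs_rpow_of_ne (p := p) ht0).const_sub c)
    refine this.congr_deriv ?_
    ring
  · rw [intervalIntegrable_iff_integrableOn_Ioc_of_le hax]
    refine IntegrableOn.of_bound (measure_Ioc_lt_top) ?_ p (Eventually.of_forall fun t => ?_)
    · exact ((measurable_absRpowDeriv p).neg.mul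
        ((measurable_truncPow n).comp (by fun_prop))).aestronglyMeasurable
    · rw [norm_mul, Real.norm_eq_abs, Real.norm_eq_abs, abs_neg, abs_of_nonneg (truncPow_nonneg _ _)]
      by_cases h : |t| ≤ 1
      · have h2 := abs_absRpowDeriv_le hp h
        have h3 := truncPow_le_one n (s := c - |t| ^ p) (by
          have : 0 ≤ |t| ^ p := by positivity
          linarith)
        nlinarith [truncPow_nonneg n (c - |t| ^ p), abs_nonneg (absRpowDeriv p t)]
      · rw [truncPow_of_nonpos, mul_zero]
        · linarith
        · have := Real.one_le_rpow (not_le.1 h).le (by linarith : 0 ≤ p)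
          linarith

/-- `(c - ∑ |x_j|^p)_+^n / n!` is the integral of its mixed derivative over `{t < x}`. -/
theorem integral_simplexDensity {p : ℝ} (hp : 1 ≤ p) (n : ℕ) {c : ℝ} (hc : c ≤ 1)
    (x : Fin n → ℝ) :
    ∫ t, simplexDensity p n c t * ∏ j, (if t j < x j then 1 else 0) =
      truncPow n (c - ∑ j, |x j| ^ p) := by
  induction n generalizing c with
  | zero =>
    rw [Measure.volume_pi_eq_dirac, integral_dirac]
    simp [simplexDensity]
  | succ n ih =>
    have hmp := (volume_preserving_piFinSuccAbove (fun _ : Fin (n + 1) => ℝ) 0).symm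
    have hmeas : Measurable fun t : Fin (n + 1) → ℝ =>
        ∏ j, (if t j < x j then (1 : ℝ) else 0) :=
      Finset.measurable_prod _ fun j _ => Measurable.ite
        (measurableSet_lt (measurable_pi_apply j) measurable_const) measurable_const
        measurable_const
    have hint : Integrable fun t : Fin (n + 1) → ℝ =>
        simplexDensity p (n + 1) c t * ∏ j, (if t j < x j then (1 : ℝ) else 0) := by
      refine (integrable_simplexDensity hp (n + 1) hc).mul_bdd (c := 1)
        hmeas.aestronglyMeasurable (Eventually.of_forall fun t => ?_)
      rw [norm_prod]
      exact Finset.prod_le_one (fun j _ => norm_nonneg _) fun j _ => by split_ifs <;> simp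
    rw [← hmp.integral_comp (MeasurableEquiv.measurableEmbedding _)]
    rw [← hmp.integrable_comp_emb (MeasurableEquiv.measurableEmbedding _)] at hint
    rw [Measure.volume_eq_prod] at hint ⊢
    refine (integral_prod _ hint).trans ?_
    -- The tail sum is absorbed into the level, so the one-variable formula handles the first
    -- coordinate, while the induction hypothesis at level `c - |s|^p` handles the others.
    rw [Fin.sum_univ_succ, ← sub_sub, sub_right_comm]
    rw [← integral_absRpowDeriv_mul_truncPow hp n (c := c - ∑ i : Fin n, |x i.succ| ^ p)
      (by have : 0 ≤ ∑ i : Fin n, |x i.succ| ^ p := Finset.sum_nonneg fun i _ => by positivity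
          linarith)]
    refine integral_congr_ae (Eventually.of_forall fun s => ?_)
    simp only [MeasurableEquiv.piFinSuccAbove_symm_apply, Fin.insertNthEquiv_zero]
    have h1 : ∀ t : Fin n → ℝ, simplexDensity p (n + 1) c (Fin.cons s t) *
        ∏ j, (if (Fin.cons s t : Fin (n + 1) → ℝ) j < x j then (1 : ℝ) else 0) =
        (if s < x 0 then -absRpowDeriv p s else 0) * (simplexDensity p n (c - |s| ^ p) t *
          ∏ j : Fin n, (if t j < x j.succ then (1 : ℝ) else 0)) := by
      intro t
      rw [simplexDensity_cons, Fin.prod_univ_succ]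
      simp only [Fin.cons_zero, Fin.cons_succ]
      split_ifs <;> ring
    have h2 := ih (c := c - |s| ^ p) (by have : 0 ≤ |s| ^ p := by positivity
                                         linarith) (fun j => x j.succ)
    calc _ = ∫ t : Fin n → ℝ, (if s < x 0 then -absRpowDeriv p s else 0) *
          (simplexDensity p n (c - |s| ^ p) t *
            ∏ j : Fin n, (if t j < x j.succ then (1 : ℝ) else 0)) :=
          integral_congr_ae (Eventually.of_forall fun t => h1 t)
      _ = _ := by
        rw [integral_const_mul, h2]
        rw [sub_right_comm]
        split_ifs <;> simp

/-! ### Weighted Fourier transform of a function with square integrable mixed derivative -/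

section Fourier

variable {d : ℕ}

theorem one_add_mul_I_ne_zero (y : ℝ) : (1 + y * Complex.I : ℂ) ≠ 0 := by
  intro h
  have := congrArg Complex.re h
  simp at this

theorem norm_inv_one_add_mul_I (y : ℝ) : ‖(1 + y * Complex.I : ℂ)⁻¹‖ = (1 + y ^ 2) ^ (-(1 / 2) : ℝ) := by
  have h : ‖(1 + y * Complex.I : ℂ)‖ = √(1 + y ^ 2) := by
    have := Complex.norm_add_mul_I 1 y
    simpa using this
  rw [norm_inv, h, Real.sqrt_eq_rpow, ← Real.rpow_neg (by positivity)]

/-- `∏ (1 + i y_j)⁻¹` is square integrable. -/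
theorem memLp_two_prod_inv_one_add_mul_I :
    MemLp (fun y : Fin d → ℝ => ∏ j, (1 + y j * Complex.I : ℂ)⁻¹) 2 := by
  have hc : Continuous fun y : Fin d → ℝ => ∏ j, (1 + y j * Complex.I : ℂ)⁻¹ :=
    continuous_finsetProd _ fun j _ => Continuous.inv₀ (by fun_prop)
      fun y => one_add_mul_I_ne_zero (y j)
  refine (memLp_two_iff_integrable_sq_norm hc.aestronglyMeasurable).2 ?_
  have h := Integrable.fintype_prod (ι := Fin d) (f := fun _ (t : ℝ) => (1 + t ^ 2)⁻¹)
    (μ := fun _ => volume) fun _ => integrable_inv_one_add_sq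
  refine h.congr (Eventually.of_forall fun y => ?_)
  simp only
  rw [norm_prod, ← Finset.prod_pow]
  refine Finset.prod_congr rfl fun j _ => ?_
  rw [norm_inv_one_add_mul_I, ← Real.rpow_mul_natCast (by positivity)]
  norm_num [Real.rpow_neg_one]

/-- Weight and character merge into a product of one-variable exponentials, which lets every
integral over a box or an orthant factor. -/
theorem exp_neg_sum_mul_exp_neg_I (x y : Fin d → ℝ) :
    Complex.exp (-((∑ j, x j : ℝ) : ℂ)) * Complex.exp (-Complex.I * ((∑ j, x j * y j : ℝ) : ℂ)) =
      ∏ j, Complex.exp (-(1 + y j * Complex.I) * x j) := by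
  rw [← Complex.exp_add, ← Complex.exp_sum]
  congr 1
  push_cast
  rw [Finset.mul_sum, ← Finset.sum_neg_distrib, ← Finset.sum_add_distrib]
  exact Finset.sum_congr rfl fun j _ => by ring

/-- Fourier transform of a function given by its mixed derivative `D`. -/
theorem fourierPi_integral_mul_indicator {D : (Fin d → ℝ) → ℝ} {F : (Fin d → ℝ) → ℝ}
    (hDm : Measurable D)
    (hD : Integrable fun t => D t * Real.exp (-∑ j, t j))
    (hF : ∀ x, F x = ∫ t, D t * ∏ j, (if t j < x j then 1 else 0)) (y : Fin d → ℝ) :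
    fourierPi (fun x => (F x : ℂ) * Complex.exp (-((∑ j, x j : ℝ) : ℂ))) y =
      (∏ j, (1 + y j * Complex.I : ℂ)⁻¹) *
        fourierPi (fun t => ((D t * Real.exp (-∑ j, t j) : ℝ) : ℂ)) y := by
  set K : (Fin d → ℝ) → (Fin d → ℝ) → ℂ := fun x t => (D t : ℂ) *
    ∏ j, (if t j < x j then Complex.exp (-(1 + y j * Complex.I) * x j) else 0) with hK
  have hKx : ∀ t, ∀ j, Integrable fun s : ℝ =>
      if t < s then Complex.exp (-(1 + y j * Complex.I) * s) else 0 := by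
    intro t j
    have := integrableOn_exp_mul_complex_Ioi (a := -(1 + y j * Complex.I)) (by simp) t
    rw [← integrable_indicator_iff measurableSet_Ioi] at this
    exact this
  have hKt : ∀ t, ∫ x, K x t = (D t : ℂ) * ∏ j, (Complex.exp (-(1 + y j * Complex.I) * t j) *
      (1 + y j * Complex.I : ℂ)⁻¹) := by
    intro t
    simp only [hK]
    rw [integral_const_mul, integral_fintype_prod_volume_eq_prod (fun j (s : ℝ) =>
      if t j < s then Complex.exp (-(1 + y j * Complex.I) * s) else 0)]
    congr 1
    refine Finset.prod_congr rfl fun j _ => ?_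
    have h1 := integral_exp_mul_complex_Ioi (a := -(1 + y j * Complex.I)) (by simp) (t j)
    rw [← integral_indicator measurableSet_Ioi] at h1
    refine Eq.trans ?_ (h1.trans ?_)
    · rfl
    · rw [neg_div_neg_eq, div_eq_mul_inv]
  -- The weight makes the integral over the orthant `{x > t}` converge, and `∫_t^∞ e^{-s} ds =
  -- e^{-t}` makes the norm exactly the function assumed integrable in `hD`; this justifies Fubini.
  have hKn : ∀ t, ∫ x, ‖K x t‖ = |D t * Real.exp (-∑ j, t j)| := by
    intro t
    simp only [hK, norm_mul, norm_prod]
    rw [integral_const_mul, integral_fintype_prod_volume_eq_prod (fun j (s : ℝ) =>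
      ‖if t j < s then Complex.exp (-(1 + y j * Complex.I) * s) else 0‖), abs_mul,
      Real.abs_exp, ← Finset.sum_neg_distrib, Real.exp_sum, Complex.norm_real, Real.norm_eq_abs]
    congr 1
    refine Finset.prod_congr rfl fun j _ => ?_
    rw [← integral_exp_neg_Ioi (t j), ← integral_indicator measurableSet_Ioi]
    refine integral_congr_ae (Eventually.of_forall fun s => ?_)
    simp only [indicator, mem_Ioi]
    split_ifs
    · rw [Complex.norm_exp]; simp
    · simp
  have hKm : Measurable (Function.uncurry K) := by
    refine Measurable.mul (by fun_prop) (Finset.measurable_prod _ fun j _ => ?_)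
    exact Measurable.ite (measurableSet_lt (by fun_prop) (by fun_prop)) (by fun_prop)
      measurable_const
  have hKi : Integrable (Function.uncurry K) (volume.prod volume) := by
    rw [integrable_prod_iff' hKm.aestronglyMeasurable]
    constructor
    · refine Eventually.of_forall fun t => ?_
      exact (Integrable.fintype_prod (f := fun j (s : ℝ) =>
        if t j < s then Complex.exp (-(1 + y j * Complex.I) * s) else 0) (μ := fun _ => volume)
        fun j => hKx (t j) j).const_mul (D t : ℂ)
    · simp only [Function.uncurry, hKn]
      exact hD.abs
  have h1 : ∀ x, (F x : ℂ) * Complex.exp (-((∑ j, x j : ℝ) : ℂ)) *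
      Complex.exp (-Complex.I * ((∑ j, x j * y j : ℝ) : ℂ)) = ∫ t, K x t := by
    intro x
    rw [mul_assoc, exp_neg_sum_mul_exp_neg_I, hF, ← integral_complex_ofReal,
      ← integral_mul_const]
    refine integral_congr_ae (Eventually.of_forall fun t => ?_)
    simp only [hK]
    push_cast
    rw [mul_assoc, ← Finset.prod_mul_distrib]
    congr 1
    refine Finset.prod_congr rfl fun j _ => ?_
    split_ifs <;> simp
  rw [fourierPi]
  simp_rw [h1]
  rw [integral_integral_swap hKi, fourierPi, ← integral_const_mul]
  refine integral_congr_ae (Eventually.of_forall fun t => ?_)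
  simp only [hKt]
  rw [Finset.prod_mul_distrib, ← exp_neg_sum_mul_exp_neg_I]
  push_cast
  ring

/-- `(1 - ∑ |x_j|^p)_+^d` is in the Wiener algebra. -/
theorem memWienerAlgebra_truncPow_sum (hd : d ≠ 0) {p : ℝ} (hp : 1 ≤ p) :
    MemWienerAlgebra d fun x => (truncPow d (1 - ∑ j, |x j| ^ p) : ℂ) := by
  have hzero : ∀ x : Fin d → ℝ, 1 < ‖x‖ → truncPow d (1 - ∑ j, |x j| ^ p) = 0 := by
    intro x hx
    obtain ⟨j, hj⟩ : ∃ j, 1 < |x j| := by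
      by_contra! h
      exact hx.not_ge ((pi_norm_le_iff_of_nonneg zero_le_one).2 h)
    refine truncPow_of_nonpos ?_
    have h1 := Real.one_le_rpow hj.le (by linarith : 0 ≤ p)
    have h2 := Finset.single_le_sum (f := fun j => |x j| ^ p) (fun i _ => by positivity)
      (Finset.mem_univ j)
    linarith
  have hcont : Continuous fun x : Fin d → ℝ => (truncPow d (1 - ∑ j, |x j| ^ p) : ℂ) *
      Complex.exp (-((∑ j, x j : ℝ) : ℂ)) := by
    refine Continuous.mul (Complex.continuous_ofReal.comp ((continuous_truncPow hd).comp ?_))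
      (by fun_prop)
    exact continuous_const.sub (continuous_finsetSum _ fun j _ =>
      (continuous_abs.comp (continuous_apply j)).rpow_const fun x => Or.inr (by linarith))
  refine MemWienerAlgebra.of_mul_exp ?_ fun x hx => by rw [hzero x hx, Complex.ofReal_zero]
  refine memWienerAlgebra_of_integrable_fourierPi hcont
    (hcont.integrable_of_hasCompactSupport ?_) ?_
  · refine HasCompactSupport.intro (isCompact_closedBall (0 : Fin d → ℝ) 1) fun x hx => ?_
    rw [mem_closedBall_zero_iff, not_le] at hx
    rw [hzero x hx, Complex.ofReal_zero, zero_mul]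
  · have hw : Continuous fun t : Fin d → ℝ => Real.exp (-∑ j, t j) := by fun_prop
    have hD := memLp_simplexDensity_mul hp d le_rfl hw
    have hDm : Measurable (simplexDensity p d 1) :=
      (measurable_simplexDensity p d).comp measurable_prodMk_left
    have h1 := fourierPi_integral_mul_indicator hDm (memLp_one_iff_integrable.1 (hD 1))
      fun x => (integral_simplexDensity hp d le_rfl x).symm
    rw [funext h1]
    -- A product of two `L²` functions: the explicit factor, and the Plancherel transform of the
    -- weighted mixed derivative.
    exact memLp_two_prod_inv_one_add_mul_I.integrable_mul
      (memLp_two_fourierPi (memLp_one_iff_integrable.1 (hD 1)).ofReal (hD 2).ofReal)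

end Fourier

/-! ### The functions `(1 - max |x_j|)_+^d` -/

section SupNorm

variable {d : ℕ}

/-- Split `b` into `d` equal factors `b^{1/d}` and give one to each `a j`, which dominates it. -/
theorem prod_mul_le_prod_rpow (hd : d ≠ 0) {a : Fin d → ℝ} {b : ℝ} (ha : ∀ j, 0 < a j)
    (hb : 0 < b) (h : ∀ j, b ≤ a j) : (∏ j, a j) * b ≤ ∏ j, a j ^ (1 + (d : ℝ)⁻¹) := by
  have h1 : b ≤ ∏ j, a j ^ (d : ℝ)⁻¹ := by
    calc b = ∏ _j : Fin d, b ^ (d : ℝ)⁻¹ := by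
          rw [Finset.prod_const, Finset.card_univ, Fintype.card_fin,
            Real.rpow_inv_natCast_pow hb.le hd]
      _ ≤ _ := Finset.prod_le_prod (fun j _ => by positivity)
          fun j _ => Real.rpow_le_rpow hb.le (h j) (by positivity)
  calc (∏ j, a j) * b ≤ (∏ j, a j) * ∏ j, a j ^ (d : ℝ)⁻¹ :=
        mul_le_mul_of_nonneg_left h1 (Finset.prod_nonneg fun j _ => (ha j).le)
    _ = _ := by
        rw [← Finset.prod_mul_distrib]
        exact Finset.prod_congr rfl fun j _ => by rw [Real.rpow_add (ha j), Real.rpow_one]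

/-- A product of `d + 1` positive numbers is at most the sum of the products of the powers with
exponent `1 + 1 / d` of `d` of them. -/
theorem prod_mul_le_sum_prod_rpow (hd : d ≠ 0) {a : Fin d → ℝ} {b : ℝ} (ha : ∀ j, 0 < a j)
    (hb : 0 < b) : (∏ j, a j) * b ≤ ∏ j, a j ^ (1 + (d : ℝ)⁻¹) +
      ∑ i, ∏ j, Function.update a i b j ^ (1 + (d : ℝ)⁻¹) := by
  have hup : ∀ i j, 0 < Function.update a i b j := by
    intro i j
    rcases eq_or_ne j i with rfl | h
    · simpa using hb
    · simpa [h] using ha j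
  have hnn : ∀ i, 0 ≤ ∏ j, Function.update a i b j ^ (1 + (d : ℝ)⁻¹) := fun i =>
    Finset.prod_nonneg fun j _ => Real.rpow_nonneg (hup i j).le _
  by_cases h : ∀ j, b ≤ a j
  · have := prod_mul_le_prod_rpow hd ha hb h
    have := Finset.sum_nonneg fun i (_ : i ∈ Finset.univ) => hnn i
    linarith
  push Not at h
  obtain ⟨k, hk⟩ := h
  have : Nonempty (Fin d) := ⟨k⟩
  -- If `b` is not the smallest of the `d + 1` numbers, it trades places with the smallest `a i`,
  -- and the previous case applies.
  obtain ⟨i, hi⟩ := Finite.exists_min a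
  have h1 : (∏ j, a j) * b = (∏ j, Function.update a i b j) * a i := by
    rw [Finset.prod_update_of_mem (Finset.mem_univ i), ← Finset.mul_prod_erase _ a
      (Finset.mem_univ i), Finset.sdiff_singleton_eq_erase]
    ring
  have h2 := prod_mul_le_prod_rpow hd (hup i) (ha i) fun j => by
    rcases eq_or_ne j i with rfl | h
    · simpa using ((hi k).trans hk.le)
    · simpa [h] using hi j
  have h3 := Finset.single_le_sum (fun i _ => hnn i) (Finset.mem_univ i)
  have h4 : 0 ≤ ∏ j, a j ^ (1 + (d : ℝ)⁻¹) :=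
    Finset.prod_nonneg fun j _ => Real.rpow_nonneg (ha j).le _
  rw [h1]
  linarith

/-- The weight `(1 + t²)^{-1/2}`. -/
noncomputable def japaneseInv (t : ℝ) : ℝ := (1 + t ^ 2) ^ (-(1 / 2) : ℝ)

theorem japaneseInv_pos (t : ℝ) : 0 < japaneseInv t := by
  unfold japaneseInv
  positivity

theorem continuous_japaneseInv : Continuous japaneseInv := by
  unfold japaneseInv
  exact Continuous.rpow_const (by fun_prop) fun t => Or.inl (by positivity)

theorem integrable_japaneseInv_rpow {q : ℝ} (hq : 1 < q) :
    Integrable fun t => japaneseInv t ^ q := by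
  have h := integrable_rpow_neg_one_add_norm_sq (E := ℝ) (μ := volume) (r := q) (by simpa using hq)
  refine h.congr (Eventually.of_forall fun t => ?_)
  simp only [japaneseInv]
  rw [← Real.rpow_mul (by positivity), Real.norm_eq_abs, sq_abs]
  congr 1
  ring

theorem integrable_comp_linearMap {G : (Fin d → ℝ) → ℝ} (hG : Integrable G)
    {T : (Fin d → ℝ) →ₗ[ℝ] (Fin d → ℝ)} (hT : Function.Injective T) :
    Integrable fun y => G (T y) := by
  have hdet : LinearMap.det T ≠ 0 := by
    have := (LinearEquiv.ofInjectiveEndo T hT).isUnit_det'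
    exact this.ne_zero
  have hmap := Measure.map_linearMap_addHaar_eq_smul_addHaar volume hdet
  have h : Integrable G (Measure.map T volume) := by
    rw [hmap]
    exact hG.smul_measure ENNReal.ofReal_ne_top
  exact h.comp_measurable T.continuous_of_finiteDimensional.measurable

/-- The product of the weights of all coordinates and of one further linear form is integrable. -/
theorem integrable_prod_japaneseInv_mul (hd : d ≠ 0) {ε : Fin d → ℝ} (hε : ∀ j, ε j ≠ 0) :
    Integrable fun y : Fin d → ℝ => (∏ j, japaneseInv (y j)) * japaneseInv (∑ j, ε j * y j) := by
  have hG : Integrable fun y : Fin d → ℝ => ∏ j, japaneseInv (y j) ^ (1 + (d : ℝ)⁻¹) := by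
    have hq : 1 < 1 + (d : ℝ)⁻¹ := by
      have : 0 < d := Nat.pos_of_ne_zero hd
      have : (0 : ℝ) < (d : ℝ)⁻¹ := by positivity
      linarith
    exact Integrable.fintype_prod (f := fun _ (t : ℝ) => japaneseInv t ^ (1 + (d : ℝ)⁻¹))
      (μ := fun _ => volume) fun _ => integrable_japaneseInv_rpow hq
  -- `T i` replaces the `i`-th coordinate by the linear form; it is injective because `ε i ≠ 0`.
  -- Each term of the majorant thus becomes an integrable product, with exponents `1 + 1/d > 1`,
  -- after a linear change of variables.
  set T : Fin d → (Fin d → ℝ) →ₗ[ℝ] (Fin d → ℝ) := fun i =>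
    LinearMap.pi fun j => if j = i then ∑ k, ε k • LinearMap.proj k else LinearMap.proj j with hT
  have hTy : ∀ i y, T i y = Function.update y i (∑ k, ε k * y k) := by
    intro i y
    ext j
    rcases eq_or_ne j i with rfl | h
    · simp [hT]
    · simp [hT, h]
  have hTi : ∀ i, Function.Injective (T i) := by
    intro i
    rw [← LinearMap.ker_eq_bot, LinearMap.ker_eq_bot']
    intro y hy
    rw [hTy] at hy
    have h1 : ∀ j, j ≠ i → y j = 0 := by
      intro j hj
      simpa [hj] using congrFun hy j
    have h2 : ∑ k, ε k * y k = 0 := by simpa using congrFun hy i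
    rw [Finset.sum_eq_single i (fun j _ hj => by rw [h1 j hj, mul_zero]) (by simp)] at h2
    ext j
    rcases eq_or_ne j i with rfl | h
    · exact (mul_eq_zero.1 h2).resolve_left (hε j)
    · exact h1 j h
  have hsum := hG.add (integrable_finsetSum Finset.univ fun i _ =>
    integrable_comp_linearMap hG (hTi i))
  refine hsum.mono' (Continuous.aestronglyMeasurable ?_) (Eventually.of_forall fun y => ?_)
  · exact (continuous_finsetProd _ fun j _ => continuous_japaneseInv.comp (continuous_apply j)).mul
      (continuous_japaneseInv.comp (by fun_prop))
  · have h := prod_mul_le_sum_prod_rpow hd (a := fun j => japaneseInv (y j))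
      (b := japaneseInv (∑ j, ε j * y j)) (fun j => japaneseInv_pos _) (japaneseInv_pos _)
    rw [Real.norm_of_nonneg (mul_nonneg (Finset.prod_nonneg fun j _ => (japaneseInv_pos _).le)
      (japaneseInv_pos _).le)]
    refine h.trans_eq ?_
    simp only [Pi.add_apply]
    congr 1
    refine Finset.sum_congr rfl fun i _ => Finset.prod_congr rfl fun j _ => ?_
    rw [hTy]
    rcases eq_or_ne j i with rfl | h
    · simp
    · simp [h]

/-- Integration by parts: decay of `∫₀¹ a(u) e^{uw} du` in vertical strips. -/
theorem exists_norm_integral_mul_exp_le {a a' : ℝ → ℂ} (ha : ∀ u, HasDerivAt a (a' u) u)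
    (ha' : Continuous a') (R : ℝ) :
    ∃ C, ∀ w : ℂ, |w.re| ≤ R →
      ‖∫ u in (0 : ℝ)..1, a u * Complex.exp (u * w)‖ ≤ C * japaneseInv w.im := by
  have hac : Continuous a := continuous_iff_continuousAt.2 fun u => (ha u).continuousAt
  obtain ⟨A, hA⟩ := (isCompact_Icc (a := (0 : ℝ)) (b := 1)).exists_bound_of_continuousOn
    hac.continuousOn
  obtain ⟨A', hA'⟩ := (isCompact_Icc (a := (0 : ℝ)) (b := 1)).exists_bound_of_continuousOn
    ha'.continuousOn
  have hA0 : 0 ≤ A := (norm_nonneg _).trans (hA 0 (by simp))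
  have hA0' : 0 ≤ A' := (norm_nonneg _).trans (hA' 0 (by simp))
  -- One `A e^R` is the trivial bound; `2 A e^R + A' e^R` bounds the boundary terms and the
  -- remaining integral after integration by parts. They add up through `√(1 + τ²) ≤ 1 + |τ|`.
  refine ⟨3 * A * Real.exp R + A' * Real.exp R, fun w hw => ?_⟩
  have hexp : ∀ u ∈ Icc (0 : ℝ) 1, ‖Complex.exp (u * w)‖ ≤ Real.exp R := by
    intro u hu
    rw [Complex.norm_exp]
    refine Real.exp_le_exp.2 ?_
    simp only [Complex.mul_re, Complex.ofReal_re, Complex.ofReal_im, zero_mul, sub_zero]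
    have := abs_le.1 hw
    have h0 : 0 ≤ R := (abs_nonneg _).trans hw
    nlinarith [hu.1, hu.2]
  set J := ∫ u in (0 : ℝ)..1, a u * Complex.exp (u * w) with hJ
  have hb : ∀ {b : ℝ → ℂ} {B : ℝ}, (∀ u ∈ Icc (0 : ℝ) 1, ‖b u‖ ≤ B) →
      ‖∫ u in (0 : ℝ)..1, b u * Complex.exp (u * w)‖ ≤ B * Real.exp R := by
    intro b B hB
    have := intervalIntegral.norm_integral_le_of_norm_le_const (a := (0 : ℝ)) (b := 1)
      (f := fun u : ℝ => b u * Complex.exp (u * w)) (C := B * Real.exp R) fun u hu => by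
        rw [uIoc_of_le zero_le_one] at hu
        have hu' : u ∈ Icc (0 : ℝ) 1 := ⟨hu.1.le, hu.2⟩
        rw [norm_mul]
        exact mul_le_mul (hB u hu') (hexp u hu') (norm_nonneg _)
          ((norm_nonneg _).trans (hB u hu'))
    simpa using this
  have h1 : ‖J‖ ≤ A * Real.exp R := hb hA
  have hder : ∀ u : ℝ, HasDerivAt (fun u : ℝ => Complex.exp (u * w)) (Complex.exp (u * w) * w) u := by
    intro u
    have := ((Complex.ofRealCLM.hasDerivAt (x := u)).mul_const w).cexp
    simpa using this
  have hparts : J * w = a 1 * Complex.exp w - a 0 - ∫ u in (0 : ℝ)..1, a' u * Complex.exp (u * w) := by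
    have := intervalIntegral.integral_mul_deriv_eq_deriv_mul (a := 0) (b := 1) (u := a)
      (v := fun u : ℝ => Complex.exp (u * w)) (fun u _ => ha u) (fun u _ => hder u)
      (ha'.intervalIntegrable _ _) (Continuous.intervalIntegrable (by fun_prop) _ _)
    simp only [← mul_assoc] at this
    rw [intervalIntegral.integral_mul_const] at this
    simpa using this
  have h2 : ‖J‖ * |w.im| ≤ 2 * A * Real.exp R + A' * Real.exp R := by
    calc ‖J‖ * |w.im| ≤ ‖J‖ * ‖w‖ :=
          mul_le_mul_of_nonneg_left (Complex.abs_im_le_norm w) (norm_nonneg _)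
      _ = ‖J * w‖ := (norm_mul _ _).symm
      _ ≤ ‖a 1 * Complex.exp w‖ + ‖a 0‖ + ‖∫ u in (0 : ℝ)..1, a' u * Complex.exp (u * w)‖ := by
          rw [hparts]
          exact (norm_sub_le _ _).trans (add_le_add_left (norm_sub_le _ _) _)
      _ ≤ A * Real.exp R + A * Real.exp R + A' * Real.exp R := by
          refine add_le_add (add_le_add ?_ ?_) (hb hA')
          · rw [norm_mul]
            have := hexp 1 (by simp)
            rw [Complex.ofReal_one, one_mul] at this
            exact mul_le_mul (hA 1 (by simp)) this (norm_nonneg _) hA0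
          · have h3 := hA 0 (by simp)
            have h4 : 1 ≤ Real.exp R := Real.one_le_exp ((abs_nonneg _).trans hw)
            nlinarith
      _ = _ := by ring
  have h3 : japaneseInv w.im = (√(1 + w.im ^ 2))⁻¹ := by
    rw [japaneseInv, Real.rpow_neg (by positivity), Real.sqrt_eq_rpow]
  rw [h3, ← div_eq_mul_inv, le_div_iff₀ (by positivity)]
  have h4 : √(1 + w.im ^ 2) ≤ 1 + |w.im| := by
    rw [Real.sqrt_le_left (by positivity)]
    nlinarith [sq_abs w.im, abs_nonneg w.im]
  calc ‖J‖ * √(1 + w.im ^ 2) ≤ ‖J‖ * (1 + |w.im|) := mul_le_mul_of_nonneg_left h4 (norm_nonneg _)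
    _ = ‖J‖ + ‖J‖ * |w.im| := by ring
    _ ≤ _ := by linarith

end SupNorm

/-! ### The sup-norm profile as a superposition of cubes -/

section SupNormBlock

theorem setIntegral_ite_lt_one_sub_pow (n : ℕ) {r : ℝ} (hr : 0 ≤ r) :
    ∫ u in Ioc (0 : ℝ) 1, (if r < u then (1 - u) ^ n / n.factorial else 0) =
      truncPow (n + 1) (1 - r) := by
  rw [← integral_indicator measurableSet_Ioc]
  have h1 : (Ioc (0 : ℝ) 1).indicator (fun u => if r < u then (1 - u) ^ n / n.factorial else 0) =
      (Ioc r 1).indicator fun u => (1 - u) ^ n / n.factorial := by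
    ext u
    simp only [indicator, mem_Ioc]
    by_cases h : r < u
    · simp [h, hr.trans_lt h]
    · simp [h]
  rw [h1, integral_indicator measurableSet_Ioc]
  rcases le_or_gt 1 r with h | h
  · rw [Ioc_eq_empty (not_lt.2 h), truncPow_of_nonpos (by linarith)]
    simp
  · rw [← intervalIntegral.integral_of_le h.le, truncPow_of_pos (by linarith),
      intervalIntegral.integral_comp_sub_left (fun v => v ^ n / (n.factorial : ℝ)),
      intervalIntegral.integral_div, integral_pow, Nat.factorial_succ]
    push_cast
    field_simp
    simp

/-- The sup norm is below `u` exactly when every coordinate is, so the layers of the profile are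
cubes, whose indicators are products over the coordinates. -/
theorem integral_prod_indicator_abs_lt (n : ℕ) (x : Fin n → ℝ) (m : ℕ) :
    ∫ u in Ioc (0 : ℝ) 1, (1 - u) ^ m / m.factorial * ∏ j, (if |x j| < u then (1 : ℝ) else 0) =
      truncPow (m + 1) (1 - ‖x‖) := by
  rw [← setIntegral_ite_lt_one_sub_pow m (norm_nonneg x)]
  refine setIntegral_congr_fun measurableSet_Ioc fun u hu => ?_
  simp only [Finset.prod_ite_zero, Finset.prod_const_one, Finset.mem_univ, true_imp_iff]
  simp_rw [← Real.norm_eq_abs, ← pi_norm_lt_iff hu.1]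
  split_ifs <;> simp

theorem integral_indicator_abs_lt_exp {u : ℝ} (hu : 0 < u) {z : ℂ} (hz : z ≠ 0) :
    ∫ s : ℝ, (if |s| < u then Complex.exp (-z * s) else 0) =
      (Complex.exp (u * z) - Complex.exp (-(u * z))) * z⁻¹ := by
  have h1 : (fun s : ℝ => if |s| < u then Complex.exp (-z * s) else 0) =
      (Ioo (-u) u).indicator fun s => Complex.exp (-z * s) := by
    ext s
    simp only [indicator, mem_Ioo, abs_lt]
  rw [h1, integral_indicator measurableSet_Ioo, ← integral_Ioc_eq_integral_Ioo,
    ← intervalIntegral.integral_of_le (by linarith),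
    integral_exp_mul_complex (neg_ne_zero.2 hz)]
  rw [div_neg, ← neg_div, neg_sub, div_eq_mul_inv]
  congr 2
  · push_cast; congr 1; ring
  · congr 1; ring

/-- Fourier transform of a superposition of cubes. -/
theorem fourierPi_truncPow_norm {d : ℕ} (m : ℕ) (y : Fin d → ℝ) :
    fourierPi (fun x => (truncPow (m + 1) (1 - ‖x‖) : ℂ) * Complex.exp (-((∑ j, x j : ℝ) : ℂ))) y =
      (∏ j, (1 + y j * Complex.I : ℂ)⁻¹) *
        ∫ u in (0 : ℝ)..1, ((((1 - u) ^ m / m.factorial : ℝ) : ℂ) *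
          ∏ j, (Complex.exp (u * (1 + y j * Complex.I)) -
            Complex.exp (-(u * (1 + y j * Complex.I))))) := by
  set K : (Fin d → ℝ) → ℝ → ℂ := fun x u => (((1 - u) ^ m / m.factorial : ℝ) : ℂ) *
    ∏ j, (if |x j| < u then Complex.exp (-(1 + y j * Complex.I) * x j) else 0) with hK
  have hKu : ∀ u ∈ Ioc (0 : ℝ) 1, ∫ x, K x u = (((1 - u) ^ m / m.factorial : ℝ) : ℂ) *
      ∏ j, ((Complex.exp (u * (1 + y j * Complex.I)) - Complex.exp (-(u * (1 + y j * Complex.I)))) *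
        (1 + y j * Complex.I : ℂ)⁻¹) := by
    intro u hu
    simp only [hK]
    rw [integral_const_mul, integral_fintype_prod_volume_eq_prod (fun j (s : ℝ) =>
      if |s| < u then Complex.exp (-(1 + y j * Complex.I) * s) else 0)]
    congr 1
    exact Finset.prod_congr rfl fun j _ =>
      integral_indicator_abs_lt_exp hu.1 (one_add_mul_I_ne_zero _)
  have hKm : Measurable (Function.uncurry K) := by
    refine Measurable.mul (by fun_prop) (Finset.measurable_prod _ fun j _ => ?_)
    exact Measurable.ite (measurableSet_lt (by fun_prop) (by fun_prop)) (by fun_prop)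
      measurable_const
  have hKi : Integrable (Function.uncurry K) (volume.prod (volume.restrict (Ioc (0 : ℝ) 1))) := by
    have hball : Integrable ((Metric.closedBall (0 : Fin d → ℝ) 1).indicator
        fun _ => Real.exp 1 ^ d) :=
      (integrable_indicator_iff Metric.isClosed_closedBall.measurableSet).2
        (integrableOn_const (isCompact_closedBall _ _).measure_lt_top.ne)
    have hone : Integrable (fun _ : ℝ => (1 : ℝ)) (volume.restrict (Ioc (0 : ℝ) 1)) :=
      integrable_const _
    have hrest : ∀ᵐ q : (Fin d → ℝ) × ℝ ∂volume.prod (volume.restrict (Ioc (0 : ℝ) 1)),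
        q.2 ∈ Ioc (0 : ℝ) 1 :=
      Measure.quasiMeasurePreserving_snd.ae (ae_restrict_mem measurableSet_Ioc)
    refine (hball.mul_prod hone).mono' hKm.aestronglyMeasurable ?_
    filter_upwards [hrest] with q hq
    simp only [Function.uncurry, hK, norm_mul, norm_prod, mul_one]
    have ha : ‖(((1 - q.2) ^ m / m.factorial : ℝ) : ℂ)‖ ≤ 1 := by
      rw [Complex.norm_real, Real.norm_of_nonneg
        (div_nonneg (pow_nonneg (by linarith [hq.2]) _) (by positivity))]
      exact div_le_one_of_le₀ ((pow_le_one₀ (by linarith [hq.2]) (by linarith [hq.1])).trans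
        (by exact_mod_cast m.factorial_pos)) (by positivity)
    by_cases hx : ∀ j, |q.1 j| ≤ 1
    · rw [indicator_of_mem (by
        rw [mem_closedBall_zero_iff, pi_norm_le_iff_of_nonneg zero_le_one]; exact hx)]
      have hP : ∏ j, ‖if |q.1 j| < q.2 then Complex.exp (-(1 + y j * Complex.I) * q.1 j) else 0‖ ≤
          Real.exp 1 ^ d := by
        refine (Finset.prod_le_prod (g := fun _ => Real.exp 1) (fun j _ => norm_nonneg _)
          fun j _ => ?_).trans_eq (by simp)
        split_ifs
        · rw [Complex.norm_exp]
          refine Real.exp_le_exp.2 ?_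
          have := neg_abs_le (q.1 j)
          simp
          linarith [hx j]
        · rw [norm_zero]; positivity
      calc _ ≤ 1 * Real.exp 1 ^ d := mul_le_mul ha hP
            (Finset.prod_nonneg fun j _ => norm_nonneg _) zero_le_one
        _ = _ := one_mul _
    · push Not at hx
      obtain ⟨j, hj⟩ := hx
      rw [Finset.prod_eq_zero (Finset.mem_univ j), mul_zero]
      · exact indicator_nonneg (fun _ _ => by positivity) _
      · rw [if_neg (by linarith [hq.2]), norm_zero]
  have h1 : ∀ x, (truncPow (m + 1) (1 - ‖x‖) : ℂ) * Complex.exp (-((∑ j, x j : ℝ) : ℂ)) *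
      Complex.exp (-Complex.I * ((∑ j, x j * y j : ℝ) : ℂ)) =
        ∫ u in Ioc (0 : ℝ) 1, K x u := by
    intro x
    rw [mul_assoc, exp_neg_sum_mul_exp_neg_I, ← integral_prod_indicator_abs_lt,
      ← integral_complex_ofReal, ← integral_mul_const]
    refine integral_congr_ae (Eventually.of_forall fun t => ?_)
    simp only [hK]
    rw [Complex.ofReal_mul, Complex.ofReal_prod, mul_assoc, ← Finset.prod_mul_distrib]
    congr 1
    refine Finset.prod_congr rfl fun j _ => ?_
    split_ifs <;> simp
  rw [fourierPi]
  simp_rw [h1]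
  rw [integral_integral_swap hKi, intervalIntegral.integral_of_le zero_le_one,
    ← integral_const_mul]
  refine setIntegral_congr_fun measurableSet_Ioc fun u hu => ?_
  rw [hKu u hu, Finset.prod_mul_distrib]
  ring

/-- `(1 - max |x_j|)_+^d` is in the Wiener algebra. -/
theorem memWienerAlgebra_truncPow_norm {d : ℕ} (hd : d ≠ 0) (m : ℕ) :
    MemWienerAlgebra d fun x => (truncPow (m + 1) (1 - ‖x‖) : ℂ) := by
  have hzero : ∀ x : Fin d → ℝ, 1 < ‖x‖ → truncPow (m + 1) (1 - ‖x‖) = 0 := fun x hx =>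
    truncPow_of_nonpos (by linarith)
  have hcont : Continuous fun x : Fin d → ℝ => (truncPow (m + 1) (1 - ‖x‖) : ℂ) *
      Complex.exp (-((∑ j, x j : ℝ) : ℂ)) :=
    (Complex.continuous_ofReal.comp ((continuous_truncPow m.succ_ne_zero).comp
      (by fun_prop))).mul (by fun_prop)
  have hsupp : HasCompactSupport fun x : Fin d → ℝ => (truncPow (m + 1) (1 - ‖x‖) : ℂ) *
      Complex.exp (-((∑ j, x j : ℝ) : ℂ)) := by
    refine HasCompactSupport.intro (isCompact_closedBall (0 : Fin d → ℝ) 1) fun x hx => ?_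
    rw [mem_closedBall_zero_iff, not_le] at hx
    rw [hzero x hx, Complex.ofReal_zero, zero_mul]
  have hint := hcont.integrable_of_hasCompactSupport (μ := volume) hsupp
  refine MemWienerAlgebra.of_mul_exp ?_ fun x hx => by rw [hzero x hx, Complex.ofReal_zero]
  refine memWienerAlgebra_of_integrable_fourierPi hcont hint ?_
  have hmeas := (memLp_two_fourierPi hint
    (hcont.memLp_of_hasCompactSupport (μ := volume) hsupp)).aestronglyMeasurable
  have hda : ∀ u : ℝ, HasDerivAt (fun u : ℝ => (((1 - u) ^ m / m.factorial : ℝ) : ℂ))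
      (((m * (1 - u) ^ (m - 1) * (-1) / m.factorial : ℝ)) : ℂ) u := fun u =>
    ((((hasDerivAt_id u).const_sub 1).pow m).div_const _).ofReal_comp
  obtain ⟨C, hC⟩ := exists_norm_integral_mul_exp_le hda (by fun_prop) d
  -- When the product of differences of exponentials is expanded, `s` collects the factors
  -- contributing the subtracted term. The resulting exponent `w s` has real part at most `d` in
  -- absolute value, whence the strip width above, and imaginary part `∑ ε s j * y j`.
  set ε : Finset (Fin d) → Fin d → ℝ := fun s j => if j ∈ s then -1 else 1 with hε
  have hbound := (integrable_finsetSum (Finset.univ : Finset (Finset (Fin d))) fun s _ =>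
    integrable_prod_japaneseInv_mul hd (ε := ε s) fun j => by
      simp only [hε]; split_ifs <;> norm_num).const_mul C
  refine hbound.mono' hmeas (Eventually.of_forall fun y => ?_)
  rw [fourierPi_truncPow_norm, norm_mul, norm_prod]
  simp_rw [norm_inv_one_add_mul_I]
  set w : Finset (Fin d) → ℂ := fun s => ∑ j, (ε s j : ℂ) * (1 + y j * Complex.I) with hw
  have hexpand : ∀ u : ℝ, ∏ j, (Complex.exp (u * (1 + y j * Complex.I)) -
      Complex.exp (-(u * (1 + y j * Complex.I)))) =
      ∑ s : Finset (Fin d), (-1) ^ s.card * Complex.exp (u * w s) := by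
    intro u
    rw [Finset.prod_sub, Finset.powerset_univ]
    refine Finset.sum_congr rfl fun s _ => ?_
    rw [mul_assoc]
    congr 1
    rw [hw, Finset.mul_sum, Complex.exp_sum, ← Finset.prod_sdiff (Finset.subset_univ s)]
    congr 1
    · refine Finset.prod_congr rfl fun j hj => ?_
      simp [hε, (Finset.mem_sdiff.1 hj).2]
    · refine Finset.prod_congr rfl fun j hj => ?_
      simp only [hε, if_pos hj]
      push_cast
      congr 1
      ring
  have hre : ∀ s, |(w s).re| ≤ d := by
    intro s
    simp only [hw, Complex.re_sum]
    refine (Finset.abs_sum_le_sum_abs _ _).trans ?_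
    refine (Finset.sum_le_sum (g := fun _ => (1 : ℝ)) fun j _ => ?_).trans_eq (by simp)
    simp only [hε]
    split_ifs <;> simp
  have him : ∀ s, (w s).im = ∑ j, ε s j * y j := by
    intro s
    simp [hw, Complex.im_sum]
  simp_rw [hexpand, Finset.mul_sum]
  rw [intervalIntegral.integral_finsetSum fun s _ => Continuous.intervalIntegrable (by fun_prop) _ _]
  have hs : ∀ s : Finset (Fin d), ‖∫ u in (0 : ℝ)..1, (((1 - u) ^ m / m.factorial : ℝ) : ℂ) *
      ((-1) ^ s.card * Complex.exp (u * w s))‖ ≤ C * japaneseInv (∑ j, ε s j * y j) := by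
    intro s
    have h1 : ∀ u : ℝ, (((1 - u) ^ m / m.factorial : ℝ) : ℂ) *
        ((-1) ^ s.card * Complex.exp (u * w s)) = (-1) ^ s.card *
          ((((1 - u) ^ m / m.factorial : ℝ) : ℂ) * Complex.exp (u * w s)) := fun u => by ring
    simp_rw [h1]
    rw [intervalIntegral.integral_const_mul, norm_mul, norm_pow, norm_neg, norm_one, one_pow,
      one_mul, ← him]
    exact hC _ (hre s)
  calc _ ≤ (∏ j, japaneseInv (y j)) * ∑ s : Finset (Fin d), C * japaneseInv (∑ j, ε s j * y j) :=
        mul_le_mul_of_nonneg_left ((norm_sum_le _ _).trans (Finset.sum_le_sum fun s _ => hs s))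
          (Finset.prod_nonneg fun j _ => (japaneseInv_pos _).le)
    _ = _ := by
        rw [Finset.mul_sum]
        exact Finset.sum_congr rfl fun s _ => by ring

end SupNormBlock

/-! ### The functions `(1 - |x|_p)_+^d` -/

section PNorm

variable {d : ℕ}

theorem MemWienerAlgebra.continuous {f : (Fin d → ℝ) → ℂ} (h : MemWienerAlgebra d f) :
    Continuous f := by
  obtain ⟨g, hg, e⟩ := h
  rw [funext e]
  refine continuous_of_dominated (fun x => (hg.mul_exp_neg_I x).aestronglyMeasurable)
    (fun x => Eventually.of_forall fun y => ?_) hg.norm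
    (Eventually.of_forall fun y => by fun_prop)
  rw [norm_mul, norm_exp_neg_I_mul_ofReal, mul_one]

/-- A continuous function which agrees off the origin with a function of the Wiener algebra belongs
to the Wiener algebra. -/
theorem MemWienerAlgebra.of_eq_off_zero (hd : d ≠ 0) {f F : (Fin d → ℝ) → ℂ}
    (hF : MemWienerAlgebra d F) (hf : Continuous f) (h : ∀ x, x ≠ 0 → f x = F x) :
    MemWienerAlgebra d f := by
  have : NeZero d := ⟨hd⟩
  have hdense : Dense ({0}ᶜ : Set (Fin d → ℝ)) := dense_compl_singleton 0
  have heq : f = F := hf.ext_on hdense hF.continuous fun x hx => h x hx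
  rwa [heq]

/-- This homogeneity turns `truncPow n (v - s)` into a dilated profile and is the source of the
weights `v^d` and `u^d` in the superpositions. -/
theorem truncPow_mul (n : ℕ) {v : ℝ} (hv : 0 < v) (s : ℝ) :
    truncPow n (v * s) = v ^ n * truncPow n s := by
  rcases lt_or_ge 0 s with h | h
  · rw [truncPow_of_pos h, truncPow_of_pos (mul_pos hv h), mul_pow, mul_div_assoc]
  · rw [truncPow_of_nonpos h, truncPow_of_nonpos (mul_nonpos_of_nonneg_of_nonpos hv.le h), mul_zero]

theorem analyticAt_one_sub_rpow_pow (β : ℝ) (n : ℕ) {s : ℝ} (hs : 0 < s) :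
    AnalyticAt ℝ (fun s : ℝ => (1 - s ^ β) ^ n) s :=
  (analyticAt_const.sub
    (Real.contDiffAt_rpow_const_of_ne hs.ne').analyticAt).pow n

/-- Since `1 - s^β` vanishes at `1`, its `n`-th power has a zero of order at least `n` there. All
Taylor terms of degree below `n` therefore drop out. -/
theorem iteratedDeriv_one_sub_rpow_pow_eq_zero (β : ℝ) {n k : ℕ} (hk : k < n) :
    iteratedDeriv k (fun s : ℝ => (1 - s ^ β) ^ n) 1 = 0 := by
  have h1 := analyticAt_one_sub_rpow_pow β 1 one_pos
  simp only [pow_one] at h1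
  refine (natCast_le_analyticOrderAt_iff_iteratedDeriv_eq_zero
    (analyticAt_one_sub_rpow_pow β n one_pos)).1 ?_ k hk
  have h2 : analyticOrderAt ((fun s : ℝ => 1 - s ^ β) ^ n) 1 = _ := analyticOrderAt_pow h1 n
  have h3 : analyticOrderAt (fun s : ℝ => 1 - s ^ β) 1 ≠ 0 := by
    rw [h1.analyticOrderAt_ne_zero]
    simp
  refine le_trans ?_ h2.ge
  rw [nsmul_eq_mul]
  exact le_mul_of_one_le_right' (Order.one_le_iff_ne_zero.2 h3)

/-- Binomial expansion into powers `s^{kβ}`; the explicit exponents show how singular the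
derivatives are at `0`. -/
theorem iteratedDeriv_one_sub_rpow_pow (β : ℝ) (n m : ℕ) {s : ℝ} (hs : 0 < s) :
    iteratedDeriv m (fun s : ℝ => (1 - s ^ β) ^ n) s =
      ∑ k ∈ Finset.range (n + 1), ((-1) ^ k * n.choose k) *
        ((descPochhammer ℝ m).eval (k * β) * s ^ (k * β - m)) := by
  have h1 : (fun s : ℝ => (1 - s ^ β) ^ n) =ᶠ[𝓝 s]
      fun s => ∑ k ∈ Finset.range (n + 1), ((-1) ^ k * n.choose k) * s ^ (k * β) := by
    filter_upwards [Ioi_mem_nhds hs] with t ht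
    rw [sub_eq_neg_add, add_pow]
    refine Finset.sum_congr rfl fun k _ => ?_
    rw [one_pow, mul_one, neg_pow, mul_comm (k : ℝ) β, Real.rpow_mul_natCast (le_of_lt ht)]
    ring
  rw [h1.iteratedDeriv_eq, iteratedDeriv_fun_sum fun k _ =>
    contDiffAt_const.mul (Real.contDiffAt_rpow_const (Or.inl hs.ne'))]
  refine Finset.sum_congr rfl fun k _ => ?_
  rw [iteratedDeriv_const_mul_field, iteratedDeriv_eq_iterate, Real.iter_deriv_rpow_const]

/-- `(1 - s^β)_+^n` is a superposition of the functions `(v - s)_+^n`. -/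
theorem exists_truncPow_one_sub_rpow_eq {β : ℝ} (hβ : 0 < β) {n : ℕ} (hn : n ≠ 0) :
    ∃ (c : ℝ) (H : ℝ → ℝ), IntegrableOn (fun v => H v * v ^ n) (Ioc 0 1) ∧
      ∀ s, 0 < s → (max (1 - s ^ β) 0) ^ n =
        c * truncPow n (1 - s) + ∫ v in Ioc (0 : ℝ) 1, H v * truncPow n (v - s) := by
  set f : ℝ → ℝ := fun s => (1 - s ^ β) ^ n with hf
  -- Taylor's formula at `1` with integral remainder: `c` is the degree `n` coefficient and `H`
  -- comes from the remainder. The signs come from replacing `s - 1` and `s - v` by their negatives,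
  -- with one more for reversing the integral.
  refine ⟨(-1) ^ n * iteratedDeriv n f 1, fun v => (-1) ^ (n + 1) * iteratedDeriv (n + 1) f v, ?_,
    fun s hs => ?_⟩
  · have hint : IntegrableOn (fun v : ℝ => ∑ k ∈ Finset.range (n + 1),
        ((-1) ^ (n + 1) * ((-1) ^ k * n.choose k) * (descPochhammer ℝ (n + 1)).eval (k * β)) *
          v ^ (k * β - 1)) (Ioc 0 1) := by
      refine integrable_finsetSum _ fun k _ => ?_
      -- The term `k = 0` would give the non-integrable `v^{-1}`, but it is the derivative of a
      -- constant and has coefficient zero; the other exponents `kβ - 1` exceed `-1`.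
      rcases Nat.eq_zero_or_pos k with rfl | hk
      · simp only [Nat.cast_zero, zero_mul, descPochhammer_eval_zero, Nat.succ_ne_zero, if_false,
          mul_zero]
        exact integrable_zero _ _ _
      · refine Integrable.const_mul ?_ _
        have h := intervalIntegral.intervalIntegrable_rpow' (a := 0) (b := 1) (r := k * β - 1)
          (by have : (0 : ℝ) < k := by exact_mod_cast hk
              have := mul_pos this hβ
              linarith)
        exact (intervalIntegrable_iff_integrableOn_Ioc_of_le zero_le_one).1 h
    refine hint.congr_fun (fun v hv => ?_) measurableSet_Ioc
    simp only [hf]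
    rw [iteratedDeriv_one_sub_rpow_pow β n (n + 1) hv.1, Finset.mul_sum, Finset.sum_mul]
    refine Finset.sum_congr rfl fun k _ => ?_
    have : v ^ (k * β - 1) = v ^ (k * β - ((n + 1 : ℕ) : ℝ)) * v ^ n := by
      rw [← Real.rpow_natCast v n, ← Real.rpow_add hv.1]
      congr 1
      push_cast
      ring
    rw [this]
    ring
  · rcases le_or_gt 1 s with h1 | h1
    · have h2 : 1 ≤ s ^ β := Real.one_le_rpow h1 hβ.le
      rw [max_eq_right (by linarith), zero_pow hn, truncPow_of_nonpos (by linarith), mul_zero,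
        zero_add]
      refine (setIntegral_eq_zero_of_forall_eq_zero fun v hv => ?_).symm
      rw [truncPow_of_nonpos (by linarith [hv.2]), mul_zero]
    have h2 : s ^ β ≤ 1 := Real.rpow_le_one hs.le h1.le hβ.le
    rw [max_eq_left (by linarith)]
    have hpos : ∀ t ∈ uIcc 1 s, 0 < t := by
      intro t ht
      rw [uIcc_of_ge h1.le] at ht
      exact hs.trans_le ht.1
    have hcd : ∀ (m : ℕ), ∀ t ∈ uIcc 1 s, ContDiffAt ℝ m f t := fun m t ht =>
      (analyticAt_one_sub_rpow_pow β n (hpos t ht)).contDiffAt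
    have htaylor := taylor_integral_remainder (f := f) (x := s) (x₀ := 1) (n := n)
      fun t ht => (hcd _ t ht).contDiffWithinAt
    have hud : UniqueDiffOn ℝ (uIcc 1 s) := uniqueDiffOn_uIcc h1.ne'
    have hiter : ∀ m : ℕ, ∀ t ∈ uIcc 1 s,
        iteratedDerivWithin m f (uIcc 1 s) t = iteratedDeriv m f t := fun m t ht =>
      iteratedDerivWithin_eq_iteratedDeriv hud (hcd m t ht) ht
    rw [taylor_within_apply, Finset.sum_range_succ, Finset.sum_eq_zero, zero_add] at htaylor
    swap
    · intro k hk
      rw [hiter _ _ left_mem_uIcc,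
        iteratedDeriv_one_sub_rpow_pow_eq_zero β (Finset.mem_range.1 hk)]
      simp
    rw [hiter _ _ left_mem_uIcc, sub_eq_iff_eq_add'] at htaylor
    change f s = _
    rw [htaylor]
    congr 1
    · rw [truncPow_of_pos (by linarith)]
      simp only [smul_eq_mul]
      rw [← neg_sub 1 s, neg_pow]
      ring
    · rw [intervalIntegral.integral_symm, intervalIntegral.integral_of_le h1.le,
        ← integral_neg, ← integral_indicator measurableSet_Ioc,
        ← integral_indicator measurableSet_Ioc]
      congr 1
      ext t
      by_cases ht : t ∈ Ioc s 1
      · have ht' : t ∈ Ioc (0 : ℝ) 1 := ⟨hs.trans ht.1, ht.2⟩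
        rw [indicator_of_mem ht, indicator_of_mem ht', hiter _ _ (by
          rw [uIcc_of_ge h1.le]; exact ⟨ht.1.le, ht.2⟩), truncPow_of_pos (by linarith [ht.1]),
          ← neg_sub t s, neg_pow, smul_eq_mul]
        ring
      · rw [indicator_of_notMem ht]
        by_cases ht' : t ∈ Ioc (0 : ℝ) 1
        · rw [indicator_of_mem ht', truncPow_of_nonpos, mul_zero]
          by_contra! h
          exact ht ⟨by linarith, ht'.2⟩
        · rw [indicator_of_notMem ht']

/-- `(1 - |x|_p)_+^d` is in the Wiener algebra for all `p ∈ [1, ∞]`. -/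
theorem memWienerAlgebra_truncPow_pNorm (hd : d ≠ 0) {p : ℝ≥0∞} (hp : 1 ≤ p) :
    MemWienerAlgebra d fun x =>
      (truncPow d (1 - ‖(WithLp.toLp p x : PiLp p (fun _ : Fin d => ℝ))‖) : ℂ) := by
  have : Fact (1 ≤ p) := ⟨hp⟩
  rcases eq_or_ne p ∞ with rfl | hpt
  · obtain ⟨m, rfl⟩ := Nat.exists_eq_succ_of_ne_zero hd
    simpa [PiLp.norm_toLp] using memWienerAlgebra_truncPow_norm hd m
  set q := p.toReal with hq
  have hq1 : 1 ≤ q := by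
    have := ENNReal.toReal_mono hpt hp
    simpa using this
  have hq0 : 0 < q := by linarith
  have hnorm : ∀ x : Fin d → ℝ, ‖(WithLp.toLp p x : PiLp p (fun _ : Fin d => ℝ))‖ =
      (∑ j, |x j| ^ q) ^ q⁻¹ := by
    intro x
    rw [PiLp.norm_eq_sum hq0, one_div]
    rfl
  obtain ⟨c, H, hH, hrep⟩ := exists_truncPow_one_sub_rpow_eq (inv_pos.2 hq0) hd
  have hblock := memWienerAlgebra_truncPow_sum hd hq1
  -- Dilating `x` by `v^{-1/q}` multiplies `∑ |x_j|^q` by `v⁻¹`. The value `1` for `v ≤ 0` only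
  -- keeps `u` positive everywhere; the integral runs over `(0, 1]`.
  set u : ℝ → ℝ := fun v => if 0 < v then v ^ q⁻¹ else 1 with hu
  have hum : Measurable u := Measurable.ite measurableSet_Ioi (by fun_prop) measurable_const
  have hupos : ∀ v, 0 < u v := by
    intro v
    simp only [hu]
    split_ifs with h
    · exact Real.rpow_pos_of_pos h _
    · exact one_pos
  have hHc : Integrable (fun v => ((H v * v ^ d : ℝ) : ℂ)) (volume.restrict (Ioc 0 1)) :=
    hH.ofReal
  have hsup := hblock.integral_dilation hum hupos hHc
  have hA := ((hblock.const_mul (c : ℂ)).add hsup).const_mul ((d.factorial : ℂ)⁻¹)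
  have hcont : Continuous fun x : Fin d → ℝ =>
      (truncPow d (1 - ‖(WithLp.toLp p x : PiLp p (fun _ : Fin d => ℝ))‖) : ℂ) :=
    Complex.continuous_ofReal.comp ((continuous_truncPow hd).comp
      (continuous_const.sub (PiLp.continuous_toLp p _).norm))
  -- The superposition formula is available only for `s > 0`, that is, off the origin; continuity
  -- covers the origin.
  refine hA.of_eq_off_zero hd hcont fun x hx => ?_
  have hσ : 0 < ∑ j, |x j| ^ q := by
    obtain ⟨j, hj⟩ := Function.ne_iff.1 hx
    exact Finset.sum_pos' (fun i _ => by positivity)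
      ⟨j, Finset.mem_univ j, Real.rpow_pos_of_pos (abs_pos.2 hj) _⟩
  rw [truncPow_eq_max hd, hnorm, hrep _ hσ, div_eq_inv_mul]
  push_cast
  rw [← integral_complex_ofReal]
  congr 2
  refine setIntegral_congr_fun measurableSet_Ioc fun v hv => ?_
  have h1 : ∑ j, |((u v)⁻¹ • x) j| ^ q = v⁻¹ * ∑ j, |x j| ^ q := by
    rw [Finset.mul_sum]
    refine Finset.sum_congr rfl fun j _ => ?_
    simp only [Pi.smul_apply, smul_eq_mul, hu, if_pos hv.1]
    rw [abs_mul, Real.mul_rpow (abs_nonneg _) (abs_nonneg _), abs_of_pos (by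
      have := hv.1; positivity), Real.inv_rpow (by have := hv.1; positivity),
      Real.rpow_inv_rpow hv.1.le hq0.ne']
  have h2 : v - ∑ j, |x j| ^ q = v * (1 - v⁻¹ * ∑ j, |x j| ^ q) := by
    have := hv.1.ne'
    field_simp
  rw [h2, truncPow_mul d hv.1]
  simp only [h1]
  push_cast
  ring

end PNorm

/-! ### Integral representation of functions of class `V_d` -/

section Density

/-- A right-continuous function whose increments are bounded by those of a Stieltjes function `S`
is an integral with respect to the measure of `S`. -/
theorem StieltjesFunction.exists_density (S : StieltjesFunction (Ioi (0 : ℝ)))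
    {r : Ioi (0 : ℝ) → ℝ} (hr : ∀ t, ContinuousWithinAt r (Ici t) t)
    (hrS : ∀ s t, s ≤ t → |r t - r s| ≤ S t - S s) :
    ∃ ρ : Ioi (0 : ℝ) → ℝ, Measurable ρ ∧ (∀ᵐ u ∂S.measure, |ρ u| ≤ 1) ∧
      ∀ s t, s ≤ t → r t - r s = ∫ u in Ioc s t, ρ u ∂S.measure := by
  -- The increment bound makes both `S - r` and `S + r` monotone. Their measures add up to twice
  -- that of `S`, so that of `S + r` has a density `D` with values in `[0, 2]`, and `D - 1` is the
  -- density sought for `r`.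
  set N₁ : StieltjesFunction (Ioi (0 : ℝ)) :=
    ⟨fun t => S t - r t, fun s t hst => by
      have := (abs_le.1 (hrS s t hst)).2
      simp only; linarith, fun t => (S.right_continuous t).sub (hr t)⟩ with hN₁
  set N₂ : StieltjesFunction (Ioi (0 : ℝ)) :=
    ⟨fun t => S t + r t, fun s t hst => by
      have := (abs_le.1 (hrS s t hst)).1
      simp only; linarith, fun t => (S.right_continuous t).add (hr t)⟩ with hN₂
  have hsum : N₁.measure + N₂.measure = S.measure + S.measure := by
    rw [← StieltjesFunction.measure_add, ← StieltjesFunction.measure_add]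
    congr 1
    ext t
    simp [hN₁, hN₂]
  have hle : N₂.measure ≤ S.measure + S.measure := by
    rw [← hsum]
    exact Measure.le_add_left le_rfl
  have hac : N₂.measure ≪ S.measure := by
    refine Measure.AbsolutelyContinuous.mk fun s _ hs => ?_
    have := hle s
    simpa [hs] using this
  set D := N₂.measure.rnDeriv S.measure with hD
  have hDm : Measurable D := Measure.measurable_rnDeriv _ _
  have hwd : S.measure.withDensity D = N₂.measure := Measure.withDensity_rnDeriv_eq _ _ hac
  have hD2 : ∀ᵐ u ∂S.measure, D u ≤ 2 := by
    refine ae_le_of_forall_setLIntegral_le_of_sigmaFinite hDm fun s hs _ => ?_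
    rw [← withDensity_apply _ hs, hwd, setLIntegral_const, two_mul]
    exact hle s
  refine ⟨fun u => (D u).toReal - 1, hDm.ennreal_toReal.sub_const 1, ?_, fun s t hst => ?_⟩
  · filter_upwards [hD2] with u hu
    have h1 : (D u).toReal ≤ 2 := by
      simpa using ENNReal.toReal_mono (by norm_num) hu
    rw [abs_le]
    constructor <;> linarith [ENNReal.toReal_nonneg (a := D u)]
  · have hfin : S.measure (Ioc s t) < ∞ := by
      rw [StieltjesFunction.measure_Ioc]
      exact ENNReal.ofReal_lt_top
    have hDint : ∫⁻ u in Ioc s t, D u ∂S.measure = ENNReal.ofReal (N₂ t - N₂ s) := by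
      rw [← withDensity_apply _ measurableSet_Ioc, hwd, StieltjesFunction.measure_Ioc]
    have hDi : IntegrableOn (fun u => (D u).toReal) (Ioc s t) S.measure :=
      integrable_toReal_of_lintegral_ne_top hDm.aemeasurable (by
        rw [hDint]; exact ENNReal.ofReal_ne_top)
    have hone : IntegrableOn (fun _ => (1 : ℝ)) (Ioc s t) S.measure :=
      integrableOn_const hfin.ne
    rw [integral_sub hDi hone, integral_toReal hDm.aemeasurable
      (ae_restrict_of_ae (hD2.mono fun u hu => hu.trans_lt (by norm_num))), hDint,
      ENNReal.toReal_ofReal (sub_nonneg.2 (N₂.mono hst)), setIntegral_const, measureReal_def,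
      StieltjesFunction.measure_Ioc, ENNReal.toReal_ofReal (sub_nonneg.2 (S.mono hst))]
    simp only [hN₂, smul_eq_mul, mul_one]
    ring

/-- The increments of a right-continuous function of locally bounded variation are bounded by those
of the right limits of its variation function. -/
theorem norm_sub_le_stieltjesFunction {g : ℝ → ℂ} (hg : LocallyBoundedVariationOn g (Ioi 0))
    (hrc : ∀ t, 0 < t → ContinuousWithinAt g (Ici t) t) {s t : Ioi (0 : ℝ)} (hst : s ≤ t) :
    ‖g t - g s‖ ≤ (monotone_variationFunction hg).stieltjesFunction t -
      (monotone_variationFunction hg).stieltjesFunction s := by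
  rcases hst.eq_or_lt with rfl | hlt
  · simp
  set V : Ioi (0 : ℝ) → ℝ := fun t => variationOnFromTo g (Ioi 0) 1 t with hV
  have hVm : Monotone V := monotone_variationFunction hg
  have h1 : ∀ s t : Ioi (0 : ℝ), s ≤ t → ‖g t - g s‖ ≤ V t - V s := by
    intro s t hst
    have h2 : V t - V s = variationOnFromTo g (Ioi 0) s t := by
      have := variationOnFromTo.add hg (mem_Ioi.2 one_pos) s.2 t.2
      simp only [hV]
      linarith
    rw [h2, variationOnFromTo.eq_of_le g (Ioi 0) hst, ← dist_eq_norm, dist_edist]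
    refine ENNReal.toReal_mono (hg s t s.2 t.2) ?_
    exact eVariationOn.edist_le g ⟨t.2, hst, le_rfl⟩ ⟨s.2, le_rfl, hst⟩
  have hgr : ∀ x : Ioi (0 : ℝ), Tendsto (fun y : Ioi (0 : ℝ) => g y) (𝓝[>] x) (𝓝 (g x)) := by
    intro x
    refine (hrc x x.2).tendsto.comp (tendsto_nhdsWithin_iff.2 ⟨?_, ?_⟩)
    · exact (continuous_subtype_val.tendsto x).mono_left nhdsWithin_le_nhds
    · filter_upwards [self_mem_nhdsWithin] with y hy
      exact le_of_lt (show (x : ℝ) < y from hy)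
  -- The bound for `V` passes to right limits first at `t`, then at `s`. Strictness `s < t` keeps
  -- the points approaching `s` from the right below `t`.
  have h3 : ∀ s' : Ioi (0 : ℝ), s' < t → ‖g t - g s'‖ ≤ Function.rightLim V t - V s' := by
    intro s' hs'
    refine le_of_tendsto_of_tendsto ((hgr t).sub_const (g s')).norm
      ((hVm.tendsto_rightLim t).sub_const (V s')) ?_
    filter_upwards [self_mem_nhdsWithin] with y hy
    exact h1 s' y (hs'.trans hy).le
  refine le_of_tendsto_of_tendsto ((hgr s).const_sub (g t)).norm
    ((hVm.tendsto_rightLim s).const_sub (Function.rightLim V t)) ?_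
  filter_upwards [mem_nhdsWithin_of_mem_nhds (Iio_mem_nhds hlt)] with y hy
  exact h3 y hy

/-- The complex measure `dg` has a bounded density with respect to `|dg|`. -/
theorem exists_density_variationMeasure {g : ℝ → ℂ} (hg : LocallyBoundedVariationOn g (Ioi 0))
    (hrc : ∀ t, 0 < t → ContinuousWithinAt g (Ici t) t) :
    ∃ h : Ioi (0 : ℝ) → ℂ, Measurable h ∧ (∀ᵐ u ∂variationMeasure hg, ‖h u‖ ≤ 2) ∧
      ∀ s t : Ioi (0 : ℝ), s ≤ t → g t - g s = ∫ u in Ioc s t, h u ∂variationMeasure hg := by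
  set S := (monotone_variationFunction hg).stieltjesFunction with hS
  have hgc : ∀ t : Ioi (0 : ℝ), ContinuousWithinAt (fun y : Ioi (0 : ℝ) => g y) (Ici t) t :=
    fun t => (hrc t t.2).comp continuous_subtype_val.continuousWithinAt fun y hy => hy
  obtain ⟨ρ₁, hm₁, hb₁, h₁⟩ := S.exists_density (r := fun t => (g t).re)
    (fun t => Complex.continuous_re.continuousAt.comp_continuousWithinAt (hgc t)) fun s t hst =>
      (Complex.abs_re_le_norm (g t - g s)).trans (norm_sub_le_stieltjesFunction hg hrc hst)
  obtain ⟨ρ₂, hm₂, hb₂, h₂⟩ := S.exists_density (r := fun t => (g t).im)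
    (fun t => Complex.continuous_im.continuousAt.comp_continuousWithinAt (hgc t)) fun s t hst =>
      (Complex.abs_im_le_norm (g t - g s)).trans (norm_sub_le_stieltjesFunction hg hrc hst)
  refine ⟨fun u => ρ₁ u + ρ₂ u * Complex.I, by fun_prop, ?_, fun s t hst => ?_⟩
  · change ∀ᵐ u ∂S.measure, _
    filter_upwards [hb₁, hb₂] with u hu₁ hu₂
    refine (norm_add_le _ _).trans ?_
    rw [norm_mul, Complex.norm_I, mul_one, Complex.norm_real, Complex.norm_real,
      Real.norm_eq_abs, Real.norm_eq_abs]
    linarith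
  · change _ = ∫ u in Ioc s t, _ ∂S.measure
    have hfin : S.measure (Ioc s t) < ∞ := by
      rw [StieltjesFunction.measure_Ioc]
      exact ENNReal.ofReal_lt_top
    have hi : ∀ {ρ : Ioi (0 : ℝ) → ℝ}, Measurable ρ → (∀ᵐ u ∂S.measure, |ρ u| ≤ 1) →
        Integrable (fun u => (ρ u : ℂ)) (S.measure.restrict (Ioc s t)) := fun hm hb =>
      (IntegrableOn.of_bound hfin hm.aestronglyMeasurable 1 (ae_restrict_of_ae hb)).ofReal
    rw [integral_add (hi hm₁ hb₁) ((hi hm₂ hb₂).mul_const _), integral_mul_const,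
      integral_complex_ofReal, integral_complex_ofReal, ← h₁ s t hst, ← h₂ s t hst]
    apply Complex.ext <;> simp

end Density

/-! ### Truncated power potentials and uniqueness of iterated integrals -/

section Representation

theorem Polynomial.exists_derivative_eq (P : Polynomial ℂ) :
    ∃ Q : Polynomial ℂ, Polynomial.derivative Q = P := by
  induction P using Polynomial.induction_on' with
  | add P₁ P₂ h₁ h₂ =>
    obtain ⟨Q₁, rfl⟩ := h₁
    obtain ⟨Q₂, rfl⟩ := h₂
    exact ⟨Q₁ + Q₂, Polynomial.derivative_add⟩
  | monomial n a =>
    refine ⟨Polynomial.monomial (n + 1) (a / (n + 1)), ?_⟩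
    rw [Polynomial.derivative_monomial, Nat.add_sub_cancel]
    congr 1
    push_cast
    have : (n : ℂ) + 1 ≠ 0 := by exact_mod_cast n.succ_ne_zero
    field_simp

theorem Polynomial.hasDerivAt_eval_ofReal (Q : Polynomial ℂ) (t : ℝ) :
    HasDerivAt (fun t : ℝ => Q.eval (t : ℂ)) (Q.derivative.eval (t : ℂ)) t :=
  (Q.hasDerivAt (t : ℂ)).comp_ofReal

/-- Iterated indefinite integrals of a constant are polynomials. -/
theorem exists_polynomial_of_iterated_integral {D : ℕ → ℝ → ℂ} {d : ℕ} {c : ℂ}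
    (h₀ : ∀ t, 0 < t → D 0 t = c)
    (hs : ∀ k < d, ∀ a b, 0 < a → a ≤ b → D (k + 1) b - D (k + 1) a = ∫ t in a..b, D k t) :
    ∀ k ≤ d, ∃ P : Polynomial ℂ, ∀ t : ℝ, 0 < t → D k t = P.eval (t : ℂ) := by
  intro k
  induction k with
  | zero => exact fun _ => ⟨Polynomial.C c, fun t ht => by rw [h₀ t ht, Polynomial.eval_C]⟩
  | succ k ih =>
    intro hk
    obtain ⟨P, hP⟩ := ih (Nat.le_of_succ_le hk)
    obtain ⟨Q, hQ⟩ := P.exists_derivative_eq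
    have hint : ∀ a b : ℝ, 0 < a → a ≤ b →
        D (k + 1) b - D (k + 1) a = Q.eval (b : ℂ) - Q.eval (a : ℂ) := by
      intro a b ha hab
      rw [hs k hk a b ha hab, ← intervalIntegral.integral_eq_sub_of_hasDerivAt
        (fun t _ => Q.hasDerivAt_eval_ofReal t)
        (Continuous.intervalIntegrable (by fun_prop) _ _), hQ]
      refine intervalIntegral.integral_congr fun t ht => hP t ?_
      rw [uIcc_of_le hab] at ht
      exact ha.trans_le ht.1
    refine ⟨Q + Polynomial.C (D (k + 1) 1 - Q.eval 1), fun t ht => ?_⟩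
    rw [Polynomial.eval_add, Polynomial.eval_C]
    rcases le_total 1 t with h | h
    · have := hint 1 t one_pos h
      rw [Complex.ofReal_one] at this
      linear_combination this
    · have := hint t 1 ht h
      rw [Complex.ofReal_one] at this
      linear_combination -this

/-- A polynomial of positive degree is unbounded along the positive real axis, and a constant equals
its limit. This removes the integration constants left by repeated integration. -/
theorem Polynomial.eq_zero_of_tendsto_zero {P : Polynomial ℂ}
    (h : Tendsto (fun t : ℝ => P.eval (t : ℂ)) atTop (𝓝 0)) : P = 0 := by
  by_cases hdeg : 0 < P.degree
  · have h1 : Tendsto (fun t : ℝ => ‖(t : ℂ)‖) atTop atTop := by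
      simpa using tendsto_abs_atTop_atTop (G := ℝ)
    have h2 := P.tendsto_norm_atTop hdeg h1
    exact absurd h.norm (not_tendsto_nhds_of_tendsto_atTop h2 _)
  · rw [Polynomial.eq_C_of_degree_le_zero (not_lt.1 hdeg)] at h ⊢
    simp only [Polynomial.eval_C] at h
    rw [tendsto_nhds_unique tendsto_const_nhds h, Polynomial.C_0]

theorem integral_truncPow_sub (k : ℕ) (u : ℝ) {a b : ℝ} :
    ∫ s in a..b, truncPow k (u - s) = truncPow (k + 1) (u - a) - truncPow (k + 1) (u - b) := by
  have hcont : Continuous fun s => -truncPow (k + 1) (u - s) :=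
    ((continuous_truncPow k.succ_ne_zero).comp (by fun_prop)).neg
  have hmono : ∀ s, s ∈ uIcc a b → |truncPow k (u - s)| ≤ (max (u - min a b) 0) ^ k := by
    intro s hs
    rw [abs_of_nonneg (truncPow_nonneg _ _)]
    unfold truncPow
    split_ifs with h
    · refine (div_le_self (by positivity) (by exact_mod_cast k.factorial_pos)).trans
        (pow_le_pow_left₀ h.le ((sub_le_sub_left hs.1 u).trans (le_max_left _ _)) k)
    · exact pow_nonneg (le_max_right _ _) _
  rw [integral_eq_of_hasDerivAt_off_countable (fun s => -truncPow (k + 1) (u - s)) _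
    (countable_singleton u) hcont.continuousOn]
  · ring
  · rintro s ⟨-, hs⟩
    have hne : u - s ≠ 0 := sub_ne_zero.2 (Ne.symm hs)
    have := ((hasDerivAt_truncPow k hne).comp s ((hasDerivAt_id s).const_sub u)).neg
    refine this.congr_deriv ?_
    ring
  · rw [intervalIntegrable_iff]
    refine IntegrableOn.of_bound (by rw [uIoc]; exact measure_Ioc_lt_top)
      ((measurable_truncPow k).comp (by fun_prop)).aestronglyMeasurable
      ((max (u - min a b) 0) ^ k) ?_
    filter_upwards [ae_restrict_mem measurableSet_uIoc] with s hs
    exact hmono s (uIoc_subset_uIcc hs)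

variable {μ : Measure (Ioi (0 : ℝ))} {h : Ioi (0 : ℝ) → ℂ} {d : ℕ}

/-- Where the left side is nonzero, `u > s ≥ a`, so `(u - s)^k ≤ u^k ≤ a^{-(d-k)} u^d`. The single
moment of order `d` thus controls all lower potentials away from `0`. -/
theorem truncPow_sub_le {k : ℕ} (hk : k ≤ d) {u a s : ℝ} (ha : 0 < a) (has : a ≤ s)
    (hu : 0 < u) : truncPow k (u - s) ≤ (a ^ (d - k))⁻¹ * u ^ d := by
  unfold truncPow
  split_ifs with hus
  · have h1 : (u - s) ^ k / k.factorial ≤ u ^ k :=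
      (div_le_self (by positivity) (by exact_mod_cast k.factorial_pos)).trans
        (pow_le_pow_left₀ hus.le (by linarith) k)
    have h2 : a ^ (d - k) ≤ u ^ (d - k) := pow_le_pow_left₀ ha.le (by linarith) _
    rw [inv_mul_eq_div, le_div_iff₀ (by positivity)]
    calc _ ≤ u ^ k * u ^ (d - k) := mul_le_mul h1 h2 (by positivity) (by positivity)
      _ = u ^ d := by rw [← pow_add, Nat.add_sub_cancel' hk]
  · positivity

/-- The potentials `t ↦ (-1)^{k+1} ∫ (u - t)_+^k / k! h(u) dμ(u)`. -/
noncomputable def stieltjesPotential (μ : Measure (Ioi (0 : ℝ))) (h : Ioi (0 : ℝ) → ℂ) (k : ℕ)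
    (t : ℝ) : ℂ :=
  (-1) ^ (k + 1) * ∫ u, (truncPow k (u - t) : ℂ) * h u ∂μ

theorem integrable_truncPow_mul (hm : Measurable h)
    (hi : Integrable (fun u : Ioi (0 : ℝ) => ((u : ℝ) ^ d : ℂ) * h u) μ) {k : ℕ} (hk : k ≤ d)
    {t : ℝ} (ht : 0 < t) : Integrable (fun u : Ioi (0 : ℝ) => (truncPow k (u - t) : ℂ) * h u) μ := by
  refine (hi.norm.const_mul ((t ^ (d - k))⁻¹)).mono' ?_ (Eventually.of_forall fun u => ?_)
  · exact ((Complex.measurable_ofReal.comp ((measurable_truncPow k).comp (by fun_prop))).mul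
      hm).aestronglyMeasurable
  · rw [norm_mul, norm_mul, Complex.norm_real, Real.norm_of_nonneg (truncPow_nonneg _ _), norm_pow,
      Complex.norm_real, Real.norm_of_nonneg (le_of_lt u.2), ← mul_assoc]
    exact mul_le_mul_of_nonneg_right (truncPow_sub_le hk ht le_rfl u.2) (norm_nonneg _)

/-- Fubini reduces this to integrating `truncPow k (u - s)` in `s`. The sign `(-1)^(k+1)` in the
potential is chosen so that each potential is an antiderivative of the preceding one. -/
theorem stieltjesPotential_succ_sub [SFinite μ] (hm : Measurable h)
    (hi : Integrable (fun u : Ioi (0 : ℝ) => ((u : ℝ) ^ d : ℂ) * h u) μ) {k : ℕ} (hk : k < d)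
    {a b : ℝ} (ha : 0 < a) (hab : a ≤ b) :
    IntervalIntegrable (stieltjesPotential μ h k) volume a b ∧
    stieltjesPotential μ h (k + 1) b - stieltjesPotential μ h (k + 1) a =
      ∫ t in a..b, stieltjesPotential μ h k t := by
  have hK : Integrable (Function.uncurry fun (s : ℝ) (u : Ioi (0 : ℝ)) =>
      (truncPow k (u - s) : ℂ) * h u) ((volume.restrict (Ioc a b)).prod μ) := by
    have hone : Integrable (fun _ : ℝ => (a ^ (d - k))⁻¹) (volume.restrict (Ioc a b)) :=
      integrable_const _
    refine (hone.mul_prod hi.norm).mono' ?_ ?_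
    · exact ((Complex.measurable_ofReal.comp ((measurable_truncPow k).comp (by fun_prop))).mul
        (hm.comp measurable_snd)).aestronglyMeasurable
    · have hrest : ∀ᵐ q : ℝ × Ioi (0 : ℝ) ∂(volume.restrict (Ioc a b)).prod μ, q.1 ∈ Ioc a b :=
        Measure.quasiMeasurePreserving_fst.ae (ae_restrict_mem measurableSet_Ioc)
      filter_upwards [hrest] with q hq
      simp only [Function.uncurry]
      rw [norm_mul, norm_mul, Complex.norm_real, Real.norm_of_nonneg (truncPow_nonneg _ _),
        norm_pow, Complex.norm_real, Real.norm_of_nonneg (le_of_lt q.2.2), ← mul_assoc]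
      exact mul_le_mul_of_nonneg_right (truncPow_sub_le hk.le ha hq.1.le q.2.2) (norm_nonneg _)
  constructor
  · rw [intervalIntegrable_iff_integrableOn_Ioc_of_le hab]
    exact hK.integral_prod_left.const_mul _
  simp only [stieltjesPotential]
  rw [intervalIntegral.integral_of_le hab, integral_const_mul, integral_integral_swap hK]
  have h1 : ∀ u : Ioi (0 : ℝ), ∫ s in Ioc a b, (truncPow k (u - s) : ℂ) * h u =
      (truncPow (k + 1) (u - a) : ℂ) * h u - (truncPow (k + 1) (u - b) : ℂ) * h u := by
    intro u
    rw [integral_mul_const, integral_complex_ofReal, ← intervalIntegral.integral_of_le hab,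
      integral_truncPow_sub, Complex.ofReal_sub, sub_mul]
  simp_rw [h1]
  rw [integral_sub (integrable_truncPow_mul hm hi hk ha)
    (integrable_truncPow_mul hm hi hk (ha.trans_le hab))]
  ring

/-- Dominated convergence with majorant `u^d ‖h u‖`: for fixed `u` the integrand is zero as soon as
`t ≥ u`. -/
theorem tendsto_stieltjesPotential (hm : Measurable h)
    (hi : Integrable (fun u : Ioi (0 : ℝ) => ((u : ℝ) ^ d : ℂ) * h u) μ) :
    Tendsto (stieltjesPotential μ h d) atTop (𝓝 0) := by
  have h1 : Tendsto (fun t : ℝ => ∫ u : Ioi (0 : ℝ), (truncPow d (u - t) : ℂ) * h u ∂μ) atTop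
      (𝓝 (∫ _u : Ioi (0 : ℝ), 0 ∂μ)) := by
    refine tendsto_integral_filter_of_dominated_convergence _ ?_ ?_ hi.norm ?_
    · refine Eventually.of_forall fun t => ?_
      exact ((Complex.measurable_ofReal.comp ((measurable_truncPow d).comp (by fun_prop))).mul
        hm).aestronglyMeasurable
    · filter_upwards [Ioi_mem_atTop (0 : ℝ)] with t ht
      refine Eventually.of_forall fun u => ?_
      rw [norm_mul, norm_mul, Complex.norm_real, Real.norm_of_nonneg (truncPow_nonneg _ _),
        norm_pow, Complex.norm_real, Real.norm_of_nonneg (le_of_lt u.2)]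
      refine mul_le_mul_of_nonneg_right ?_ (norm_nonneg _)
      simpa using truncPow_sub_le (le_refl d) ht le_rfl u.2
    · refine Eventually.of_forall fun u => ?_
      refine tendsto_const_nhds.congr' ?_
      filter_upwards [Ici_mem_atTop (u : ℝ)] with t ht
      rw [truncPow_of_nonpos (sub_nonpos.2 ht), Complex.ofReal_zero, zero_mul]
  rw [integral_zero] at h1
  have h2 := h1.const_mul ((-1 : ℂ) ^ (d + 1))
  rw [mul_zero] at h2
  exact h2

/-- The iterated integrals of `g` which tend to zero at infinity are given by the potentials of the
measure `dg = h dμ`. -/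
theorem eq_stieltjesPotential [SFinite μ] (hm : Measurable h)
    (hi : Integrable (fun u : Ioi (0 : ℝ) => ((u : ℝ) ^ d : ℂ) * h u) μ) {φ : ℕ → ℝ → ℂ}
    (h₀ : ∀ s t : Ioi (0 : ℝ), s ≤ t → φ 0 t - φ 0 s = ∫ u in Ioc s t, h u ∂μ)
    (hφi : ∀ k, 0 < k → k < d → ∀ a b, 0 < a → a ≤ b → IntervalIntegrable (φ k) volume a b)
    (hφ : ∀ k < d, ∀ a b, 0 < a → a ≤ b → φ (k + 1) b - φ (k + 1) a = ∫ t in a..b, φ k t)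
    (hlim : Tendsto (φ d) atTop (𝓝 0)) {t : ℝ} (ht : 0 < t) :
    φ d t = stieltjesPotential μ h d t := by
  -- `D 0` is constant because both terms have the same increments. Hence `D d` is a polynomial on
  -- `(0, ∞)`, and it tends to zero at infinity.
  set D : ℕ → ℝ → ℂ := fun k t => φ k t - stieltjesPotential μ h k t with hD
  have hinc : ∀ s t : Ioi (0 : ℝ), s ≤ t → D 0 t = D 0 s := by
    intro s t hst
    have h1 : stieltjesPotential μ h 0 t - stieltjesPotential μ h 0 s =
        ∫ u in Ioc s t, h u ∂μ := by
      have hsub := integral_sub (integrable_truncPow_mul hm hi (Nat.zero_le d) s.2)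
        (integrable_truncPow_mul hm hi (Nat.zero_le d) t.2)
      have h2 : ∫ u in Ioc s t, h u ∂μ = ∫ u : Ioi (0 : ℝ),
          ((truncPow 0 (u - s) : ℂ) * h u - (truncPow 0 (u - t) : ℂ) * h u) ∂μ := by
        rw [← integral_indicator measurableSet_Ioc]
        refine integral_congr_ae (Eventually.of_forall fun u => ?_)
        simp only [truncPow, pow_zero, Nat.factorial_zero, Nat.cast_one, div_one, sub_pos,
          Subtype.coe_lt_coe, indicator, mem_Ioc]
        by_cases hs : s < u
        · by_cases ht : t < u
          · simp [hs, ht]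
          · simp [hs, ht, not_lt.1 ht]
        · have ht : ¬ t < u := fun h' => hs (hst.trans_lt h')
          simp [hs, ht]
      rw [h2, hsub]
      simp only [stieltjesPotential]
      ring
    have h3 := h₀ s t hst
    simp only [hD]
    linear_combination h3 - h1
  have hD0 : ∀ t, 0 < t → D 0 t = D 0 1 := by
    intro t ht
    rcases le_total 1 t with h | h
    · exact hinc ⟨1, mem_Ioi.2 one_pos⟩ ⟨t, ht⟩ h
    · exact (hinc ⟨t, ht⟩ ⟨1, mem_Ioi.2 one_pos⟩ h).symm
  obtain ⟨P, hP⟩ := exists_polynomial_of_iterated_integral hD0 (d := d) (fun k hk a b ha hab => by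
    obtain ⟨h1, h2⟩ := stieltjesPotential_succ_sub hm hi hk ha hab
    simp only [hD]
    -- At level `0` integrability is not assumed; there `φ 0` is a constant plus an integrable
    -- potential.
    have h3 : IntervalIntegrable (φ k) volume a b := by
      rcases Nat.eq_zero_or_pos k with rfl | hk0
      · refine (h1.add (intervalIntegrable_const (c := D 0 1))).congr fun t ht => ?_
        rw [uIoc_of_le hab] at ht
        rw [← hD0 t (ha.trans ht.1)]
        simp [hD]
      · exact hφi k hk0 hk a b ha hab
    rw [intervalIntegral.integral_sub h3 h1, ← h2, ← hφ k hk a b ha hab]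
    ring) d le_rfl
  have hP0 : P = 0 := by
    refine Polynomial.eq_zero_of_tendsto_zero ?_
    have h1 := hlim.sub (tendsto_stieltjesPotential hm hi)
    rw [sub_zero] at h1
    refine h1.congr' ?_
    filter_upwards [Ioi_mem_atTop (0 : ℝ)] with t ht
    exact hP t ht
  have := hP t ht
  rw [hP0, Polynomial.eval_zero] at this
  exact sub_eq_zero.1 this

end Representation

/-! ### Iterated derivatives on the open half-line -/

section Derivatives

variable {f : ℝ → ℂ} {n k : ℕ}

theorem continuousOn_iteratedDeriv_Ioi (hf : ContDiffOn ℝ n f (Ioi 0)) (hk : k ≤ n) :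
    ContinuousOn (iteratedDeriv k f) (Ioi 0) :=
  (hf.continuousOn_iteratedDerivWithin (by exact_mod_cast hk) isOpen_Ioi.uniqueDiffOn).congr
    fun _ ht => (iteratedDerivWithin_of_isOpen isOpen_Ioi ht).symm

theorem hasDerivAt_iteratedDeriv_Ioi (hf : ContDiffOn ℝ n f (Ioi 0)) (hk : k < n) {t : ℝ}
    (ht : 0 < t) : HasDerivAt (iteratedDeriv k f) (iteratedDeriv (k + 1) f t) t := by
  have h1 : DifferentiableOn ℝ (iteratedDeriv k f) (Ioi 0) :=
    (hf.differentiableOn_iteratedDerivWithin (by exact_mod_cast hk)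
      isOpen_Ioi.uniqueDiffOn).congr
        fun _ ht => (iteratedDerivWithin_of_isOpen isOpen_Ioi ht).symm
  rw [iteratedDeriv_succ]
  exact ((h1 t ht).differentiableAt (Ioi_mem_nhds ht)).hasDerivAt

theorem intervalIntegrable_iteratedDeriv (hf : ContDiffOn ℝ n f (Ioi 0)) (hk : k ≤ n) {a b : ℝ}
    (ha : 0 < a) (hab : a ≤ b) : IntervalIntegrable (iteratedDeriv k f) volume a b := by
  refine ((continuousOn_iteratedDeriv_Ioi hf hk).mono fun t ht => ?_).intervalIntegrable
  rw [uIcc_of_le hab] at ht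
  exact ha.trans_le ht.1

theorem iteratedDeriv_sub_eq_integral (hf : ContDiffOn ℝ n f (Ioi 0)) (hk : k < n) {a b : ℝ}
    (ha : 0 < a) (hab : a ≤ b) :
    iteratedDeriv k f b - iteratedDeriv k f a = ∫ t in a..b, iteratedDeriv (k + 1) f t := by
  refine (intervalIntegral.integral_eq_sub_of_hasDerivAt (fun t ht => ?_)
    (intervalIntegrable_iteratedDeriv hf hk ha hab)).symm
  rw [uIcc_of_le hab] at ht
  exact hasDerivAt_iteratedDeriv_Ioi hf hk (ha.trans_le ht.1)

end Derivatives

/-! ### Representation of `f₀` and conclusion -/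

/-- Functions of class `V_d` which tend to zero at infinity are superpositions of the functions
`(u - t)_+^d`. -/
theorem MemV.exists_eq_stieltjesPotential {d : ℕ} (hd : d ≠ 0) {f : ℝ → ℂ} (hV : MemV d f)
    (hlim : Tendsto f atTop (𝓝 0)) :
    ∃ (μ : Measure (Ioi (0 : ℝ))) (_ : SFinite μ) (h : Ioi (0 : ℝ) → ℂ),
      Integrable (fun u : Ioi (0 : ℝ) => ((u : ℝ) ^ d : ℂ) * h u) μ ∧
        ∀ t, 0 < t → f t = stieltjesPotential μ h d t := by
  obtain ⟨-, g, hg, hfin⟩ := hV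
  obtain ⟨h, hm, hb, hdg⟩ := exists_density_variationMeasure hg.locallyBV hg.rightCont
  have hsf : SFinite (variationMeasure hg.locallyBV) := by
    unfold variationMeasure
    infer_instance
  have hpow : Integrable (fun u : Ioi (0 : ℝ) => (((u : ℝ) ^ d : ℝ) : ℂ))
      (variationMeasure hg.locallyBV) := by
    have hr : Integrable (fun u : Ioi (0 : ℝ) => (u : ℝ) ^ d) (variationMeasure hg.locallyBV) := by
      refine ⟨(measurable_subtype_coe.pow_const d).aestronglyMeasurable, ?_⟩
      rw [hasFiniteIntegral_iff_ofReal
        (Eventually.of_forall fun u : Ioi (0 : ℝ) => pow_nonneg (le_of_lt u.2) d)]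
      exact hfin
    exact hr.ofReal
  have hi : Integrable (fun u : Ioi (0 : ℝ) => ((u : ℝ) ^ d : ℂ) * h u)
      (variationMeasure hg.locallyBV) := by
    simpa using hpow.mul_bdd (c := 2) hm.aestronglyMeasurable hb
  refine ⟨variationMeasure hg.locallyBV, hsf, h, hi, fun t ht => ?_⟩
  have hcd : ContDiffOn ℝ (d - 1 : ℕ) f (Ioi 0) := hg.contDiffOn
  have hφd : (if d = 0 then g else iteratedDeriv (d - d) f) = f := by
    simp [hd]
  -- The chain counts derivatives downwards: `φ k` is `f^{(d-k)}`. At `k = 0` it must be the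
  -- representative `g`, since `f^{(d-1)}` need not be differentiable at the jumps.
  have key := eq_stieltjesPotential hm hi (d := d)
    (φ := fun k => if k = 0 then g else iteratedDeriv (d - k) f) (fun s t hst => by
      simpa using hdg s t hst) (fun k hk0 hk a b ha hab => by
      simp only [hk0.ne', if_false]
      exact intervalIntegrable_iteratedDeriv hcd (by omega) ha hab) (fun k hk a b ha hab => by
      rcases Nat.eq_zero_or_pos k with rfl | hk0
      · simpa using hg.integral_eq a b ha hab
      · simp only [hk0.ne', if_false, Nat.succ_ne_zero]
        rw [show d - k = d - (k + 1) + 1 by omega]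
        exact iteratedDeriv_sub_eq_integral hcd (by omega) ha hab) (by rw [hφd]; exact hlim) ht
  rw [hφd] at key
  exact key

/-- Here `‖WithLp.toLp p x‖` is `|x|_{p,d}`, i.e. `(∑ |x_j|^p)^{1/p}` for `p < ∞` and `max |x_j|`
for `p = ∞`; the hypotheses `hcont` and `hlim` say `f₀ ∈ C₀[0, ∞)`. -/
theorem mainTheorem3 (d : ℕ) (hd : 1 ≤ d) (f₀ : ℝ → ℂ)
    (hcont : ContinuousOn f₀ (Ici 0)) (hlim : Tendsto f₀ atTop (𝓝 0))
    (hV : MemV d f₀) (p : ℝ≥0∞) (hp : 1 ≤ p) :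
    MemWienerAlgebra d (fun x => f₀ ‖(WithLp.toLp p x : PiLp p (fun _ : Fin d => ℝ))‖) := by
  have : Fact (1 ≤ p) := ⟨hp⟩
  have hd0 : d ≠ 0 := Nat.one_le_iff_ne_zero.1 hd
  obtain ⟨μ, hμ, h, hi, hrep⟩ := hV.exists_eq_stieltjesPotential hd0 hlim
  -- The dilation weight is `u^d h(u)`, integrable by the moment condition; the factor `u^d` is what
  -- homogeneity extracts from `(u - |x|_p)_+^d`.
  have hA := ((memWienerAlgebra_truncPow_pNorm hd0 hp).integral_dilation measurable_subtype_coe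
    (fun u : Ioi (0 : ℝ) => u.2) hi).const_mul ((-1) ^ (d + 1))
  have hc : Continuous fun x : Fin d → ℝ =>
      f₀ ‖(WithLp.toLp p x : PiLp p (fun _ : Fin d => ℝ))‖ :=
    hcont.comp_continuous (PiLp.continuous_toLp p _).norm fun x => norm_nonneg _
  refine hA.of_eq_off_zero hd0 hc fun x hx => ?_
  have hx0 : 0 < ‖(WithLp.toLp p x : PiLp p (fun _ : Fin d => ℝ))‖ :=
    norm_pos_iff.2 fun h0 => hx (by simpa using h0)
  rw [hrep _ hx0, stieltjesPotential]
  congr 1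
  refine integral_congr_ae (Eventually.of_forall fun u => ?_)
  have hu : (0 : ℝ) < u := u.2
  simp only
  rw [WithLp.toLp_smul, norm_smul, Real.norm_of_nonneg (inv_nonneg.2 hu.le)]
  have h1 : (u : ℝ) - ‖(WithLp.toLp p x : PiLp p (fun _ : Fin d => ℝ))‖ =
      u * (1 - (u : ℝ)⁻¹ * ‖(WithLp.toLp p x : PiLp p (fun _ : Fin d => ℝ))‖) := by
    field_simp
  rw [h1, truncPow_mul d hu]
  push_cast
  ring
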